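/- Let $X$ be a Polish space with a metric inducing its topology; bounded sets refer to this metric. Let $\mathcal M^{\cdot\cdot}(X)$ be the set of Borel measures on $X$ that take values in $\{0,1,2,\dots\}$ on bounded Borel sets (locally finite point measures, multiple points allowed), with the $\sigma$-algebra generated by the maps $\mu\mapsto\mu(B)$, $B$ Borel. A point process is a probability measure $P$ on $\mathcal M^{\cdot\cdot}(X)$; it is of first order if its first moment measure $\nu_P(B)=\int \mu(B)\,P(\mathrm d\mu)$ is finite on bounded Borel sets $B$. It is a Poisson point process if there is a Borel measure $\varrho$ on $X$, finite on bounded sets, such that under $P$ the variable $\mu(B)$ is Poisson distributed with parameter $\varrho(B)$ for every bounded Borel set $B$, and $\mu(B_1),\dots,\mu(B_k)$ are independent for pairwise disjoint bounded Borel sets $B_1,\dots,B_k$. For $s\in(0,1)$ the independent $s$-thinning of $\mu\in\mathcal M^{\cdot\cdot}(X)$ is the law $$T^\mu_s=\mathop{\ast}_{x\in\mu}\big((1-s)\,\delta_{\mathbf 0}+s\,\delta_{\delta_x}\big)^{\ast\mu(\{x\})},$$ where $\mathbf 0$ is the zero measure, the convolution runs over the points $x$ with $\mu(\{x\})>0$,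 and the convolution of a family of laws is the law of the sum of independent point measures with these laws. The $s$-thinning of a point process $P$ is $\Gamma_s(P)=\int P(\mathrm d\mu)\,T^\mu_s$. For $q=(q_1,\dots,q_n)$ with $q_1,\dots,q_n\in(0,1)$ and $q_1+\dots+q_n=1$, put $s_m=q_m/(q_m+\dots+q_n)$ for $1\le m\le n-1$. The multi-splitting law $S^n_q(P)$ is the law on $\mathcal M^{\cdot\cdot}(X)^n$ given, for non-negative measurable $h$, by $$S^n_q(P)(h)=\int P(\mathrm d\mu)\,T^\mu_{s_1}(\mathrm d\kappa_1)\,T^{\mu-\kappa_1}_{s_2}(\mathrm d\kappa_2)\cdots T^{\mu-(\kappa_1+\dots+\kappa_{n-2})}_{s_{n-1}}(\mathrm d\kappa_{n-1})\;h\big(\kappa_1,\dots,\kappa_{n-1},\mu-(\kappa_1+\dots+\kappa_{n-1})\big).$$ **Theorem.** Let $P$ be a point process of first order and let $q_1,\dots,q_n\in(0,1)$ satisfy $q_1+\dots+q_n=1$. Then $P$ is a Poisson point process if and only if $$S^n_q(P)=\Gamma_{q_1}(P)\otimes\dots\otimes\Gamma_{q_n}(P).$$ -/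

import Mathlib

open MeasureTheory ProbabilityTheory
open scoped ENNReal

namespace PointProcess

/-- A (Borel) measure is locally finite if it is finite on bounded Borel sets. -/
def IsLocallyFinite {X : Type*} [MetricSpace X] [MeasurableSpace X] (μ : Measure X) : Prop :=
  ∀ B : Set X, MeasurableSet B → Bornology.IsBounded B → μ B < ∞

/-- Locally finite (Radon) point measures: the mass of every bounded Borel set is a
(finite) natural number. Multiple points are allowed. -/
def IsPointMeasure {X : Type*} [MetricSpace X] [MeasurableSpace X] (μ : Measure X) : Prop :=
  ∀ B : Set X, MeasurableSet B → Bornology.IsBounded B → ∃ k : ℕ, μ B = k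

/-- The space of Radon point measures, with the sigma-algebra that it inherits from
`Measure X`, which is generated by the evaluations `μ ↦ μ B`. -/
abbrev PointMeasure (X : Type*) [MetricSpace X] [MeasurableSpace X] : Type _ :=
  {μ : Measure X // IsPointMeasure μ}

section

variable {X : Type*} [MetricSpace X] [MeasurableSpace X]

theorem isPointMeasure_zero : IsPointMeasure (0 : Measure X) :=
  fun _ _ _ => ⟨0, by simp⟩

theorem isPointMeasure_dirac (x : X) : IsPointMeasure (Measure.dirac x) := by
  intro B hB _
  by_cases hx : x ∈ B
  · exact ⟨1, by simp [Measure.dirac_apply' x hB, hx]⟩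
  · exact ⟨0, by simp [Measure.dirac_apply' x hB, hx]⟩

/-- Removing from a point measure a point measure that it dominates leaves a point measure. -/
theorem isPointMeasure_sub {μ κ : Measure X} (hμ : IsPointMeasure μ) (hκ : IsPointMeasure κ)
    (h : κ ≤ μ) : IsPointMeasure (μ - κ) := by
  intro B hB hb
  obtain ⟨m, hm⟩ := hμ B hB hb
  obtain ⟨k, hk⟩ := hκ B hB hb
  have hfin : IsFiniteMeasure (κ.restrict B) := ⟨by simp [hk]⟩
  refine ⟨m - k, ?_⟩
  rw [← Measure.restrict_apply_self (μ - κ) B,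
    Measure.restrict_sub_eq_restrict_sub_restrict hB,
    Measure.sub_apply hB (Measure.restrict_mono le_rfl h),
    Measure.restrict_apply_self, Measure.restrict_apply_self, hm, hk]
  norm_cast

/-- The empty configuration. -/
def emptyConfig (X : Type*) [MetricSpace X] [MeasurableSpace X] : PointMeasure X :=
  ⟨0, isPointMeasure_zero⟩

/-- The configuration with a single point at `x`. -/
noncomputable def pointConfig (x : X) : PointMeasure X :=
  ⟨Measure.dirac x, isPointMeasure_dirac x⟩

open scoped Classical in
/-- The remaining configuration `μ - κ` for a sub-configuration `κ ≤ μ` (and the empty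
configuration if `κ` is not a sub-configuration of `μ`). -/
noncomputable def residual (μ κ : PointMeasure X) : PointMeasure X :=
  if h : κ.1 ≤ μ.1 then ⟨μ.1 - κ.1, isPointMeasure_sub μ.2 κ.2 h⟩ else emptyConfig X

open scoped Classical in
/-- The sum of a family of point measures, where it is locally finite
(and the empty configuration elsewhere). -/
noncomputable def superposition {ι : Type*} (η : ι → PointMeasure X) : PointMeasure X :=
  if h : IsPointMeasure (Measure.sum fun i => (η i).1) then ⟨_, h⟩ else emptyConfig X

/-- The convolution of a family of laws on point measures: the law of the sum of independent
point measures with these laws. -/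
noncomputable def convolution {ι : Type*} (Q : ι → Measure (PointMeasure X)) :
    Measure (PointMeasure X) :=
  (Measure.infinitePi Q).map superposition

/-- The points of `μ` counted with multiplicity: pairs `(x, k)` with `k < μ {x}`. -/
abbrev Points (μ : PointMeasure X) : Type _ :=
  {p : X × ℕ // (p.2 : ℝ≥0∞) < μ.1 {p.1}}

/-- The independent `q`-thinning of the point measure `μ`: the convolution, over the points `x`
of `μ` counted with multiplicity, of the laws `(1 - q) δ_0 + q δ_{δ_x}`. -/
noncomputable def thinningKernel (q : ℝ) (μ : PointMeasure X) : Measure (PointMeasure X) :=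
  convolution fun p : Points μ =>
    ENNReal.ofReal (1 - q) • Measure.dirac (emptyConfig X) +
      ENNReal.ofReal q • Measure.dirac (pointConfig p.1.1)

/-- The independent `q`-thinning of the point process `P`: the mixture under `P` of the
`q`-thinnings of point measures. -/
noncomputable def thinning (q : ℝ) (P : Measure (PointMeasure X)) : Measure (PointMeasure X) :=
  P.bind (thinningKernel q)

/-- Iterated thinning of `μ` into `n + 1` parts: `κ_0` is an `s_0`-thinning of `μ`, then `κ_1` is
an `s_1`-thinning of `μ - κ_0`, and so on; the last part is `μ - (κ_0 + ⋯ + κ_{n-1})`. -/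
noncomputable def multiThinningKernel : (n : ℕ) → (Fin n → ℝ) → PointMeasure X →
    Measure (Fin (n + 1) → PointMeasure X)
  | 0, _, μ => Measure.dirac fun _ => μ
  | n + 1, s, μ => (thinningKernel (s 0) μ).bind fun κ =>
      (multiThinningKernel n (Fin.tail s) (residual μ κ)).map
        (Fin.cons (α := fun _ => PointMeasure X) κ)

/-- The multi-splitting law of `P` into `n + 1` parts with probabilities `q`: iterated thinning
with `s_m = q_m / (q_m + ⋯ + q_n)`, where `m < n` (indices start from `0`). -/
noncomputable def multiSplitting {n : ℕ} (q : Fin (n + 1) → ℝ) (P : Measure (PointMeasure X)) :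
    Measure (Fin (n + 1) → PointMeasure X) :=
  P.bind (multiThinningKernel n fun m =>
    q m.castSucc / ∑ i ∈ Finset.Ici m.castSucc, q i)

/-- The first moment measure `B ↦ ∫ μ(B) P(dμ)`. -/
noncomputable def firstMoment (P : Measure (PointMeasure X)) : Measure X :=
  P.bind Subtype.val

/-- `P` is of first order if its first moment measure is locally finite. -/
def IsFirstOrder (P : Measure (PointMeasure X)) : Prop :=
  IsLocallyFinite (firstMoment P)

/-- `P` is the Poisson point process with intensity `ϱ`: the mass of every bounded Borel set `B`
is Poisson distributed with parameter `ϱ B`, and the masses of finitely many pairwise disjoint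
bounded Borel sets are independent. -/
def IsPoissonWith (ϱ : Measure X) (P : Measure (PointMeasure X)) : Prop :=
  (∀ B : Set X, MeasurableSet B → Bornology.IsBounded B →
    P.map (fun μ => μ.1 B) =
      (poissonMeasure (ϱ B).toNNReal).map (fun k : ℕ => (k : ℝ≥0∞))) ∧
  ∀ (k : ℕ) (B : Fin k → Set X), (∀ i, MeasurableSet (B i)) →
    (∀ i, Bornology.IsBounded (B i)) → Pairwise (fun i j => Disjoint (B i) (B j)) →
    iIndepFun (fun (i : Fin k) (μ : PointMeasure X) => μ.1 (B i)) P

/-- `P` is a Poisson point process, with some locally finite intensity. -/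
def IsPoisson (P : Measure (PointMeasure X)) : Prop :=
  ∃ ϱ : Measure X, IsLocallyFinite ϱ ∧ IsPoissonWith ϱ P

end

end PointProcess

namespace PointProcess

open Filter Topology

/-! Everything is read off the probability generating functional G(u) = ∫ ∏_{x∈μ} u(x) P(dμ), taken
over simple u with values in (0, 1] that equal 1 off a bounded set.

If each point of μ is kept independently with probability s, weighting kept points by u and the
others by v gives on average ∏ (s u + (1 - s) v) (`lintegral_thinningKernel_residual`). Iterating,
the splitting law turns u_1, ..., u_n into G(∑ q_j u_j) (`lintegral_multiSplitting`), while the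
product of the thinnings gives ∏ G(1 - q_j (1 - u_j)). Such functionals determine laws
(`ext_of_lintegral_tupleProd`), so the splitting condition says exactly that these two expressions
agree. For a Poisson process G(u) = exp(-∫ (1 - u) dϱ), and they agree because the exponent is
linear in 1 - u.

Conversely, fix u, put φ(t) = G(1 - t (1 - u)) and take all u_j equal to 1 - t (1 - u). The
condition becomes φ(t) = ∏ φ(q_j t). Finite first moments give φ the right derivative -∫ (1 - u)
dν_P at 0 (`tendsto_integral_pointProd_interp`). Now -log φ is additive under t = ∑ q_j t and has a
slope at 0, hence its value at 1 is that slope (`eq_of_tendsto_div_of_sum`). So G is the generating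
functional of a Poisson process with intensity ν_P, and this yields the joint laws of counts
(`isPoissonWith_of_integral_pointProd`). -/

theorem exists_polynomial_tendsto_indicator (c : ℝ) :
    ∃ p : ℕ → Polynomial ℝ, (∀ k, ∀ x ∈ Set.Icc (0 : ℝ) 1, |(p k).eval x| ≤ 2) ∧
      ∀ x ∈ Set.Icc (0 : ℝ) 1,
        Tendsto (fun k => (p k).eval x) atTop (𝓝 ((Set.Ici c).indicator 1 x)) := by
  -- A continuous ramp equal to 1 on [c, ∞) and, for k > 0, to 0 below c - 1/k. Weierstrass
  -- approximation within 1/(k+1) preserves the limit and costs at most 1 in the bound, hence the 2.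
  let φ : ℕ → ℝ → ℝ := fun k x => max 0 (1 - k * max 0 (c - x))
  have hφ : ∀ k, Continuous (φ k) := fun k => by fun_prop
  have hex : ∀ k : ℕ, ∃ p : Polynomial ℝ, ∀ x ∈ Set.Icc (0 : ℝ) 1,
      |p.eval x - φ k x| < 1 / ((k : ℝ) + 1) := fun k =>
    exists_polynomial_near_of_continuousOn 0 1 (φ k) (hφ k).continuousOn _ (by positivity)
  choose p hp using hex
  have hφ01 : ∀ k x, 0 ≤ φ k x ∧ φ k x ≤ 1 := fun k x => by
    refine ⟨le_max_left _ _, max_le zero_le_one ?_⟩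
    have : (0 : ℝ) ≤ k * max 0 (c - x) := by positivity
    linarith
  refine ⟨p, fun k x hx => ?_, fun x hx => ?_⟩
  · have h1 := (hp k x hx).le
    have h2 : 1 / ((k : ℝ) + 1) ≤ 1 := by
      rw [div_le_one (by positivity)]; linarith [(Nat.cast_nonneg k : (0 : ℝ) ≤ k)]
    have h3 := hφ01 k x
    rw [abs_le] at h1 ⊢
    constructor <;> linarith
  · have h1 : Tendsto (fun k => (p k).eval x - φ k x) atTop (𝓝 0) :=
      squeeze_zero_norm (fun k => (hp k x hx).le) tendsto_one_div_add_atTop_nhds_zero_nat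
    have h2 : Tendsto (fun k => φ k x) atTop (𝓝 ((Set.Ici c).indicator 1 x)) := by
      by_cases hc : c ≤ x
      · have : ∀ k, φ k x = 1 := fun k => by simp [φ, max_eq_left (sub_nonpos.2 hc)]
        simp [this, hc]
      · push Not at hc
        have hpos : 0 < c - x := by linarith
        rw [Set.indicator_of_notMem (by simpa using hc)]
        have h3 : Tendsto (fun k : ℕ => (k : ℝ) * (c - x)) atTop atTop :=
          tendsto_natCast_atTop_atTop.atTop_mul_const hpos
        refine tendsto_const_nhds.congr' ?_
        filter_upwards [h3.eventually_ge_atTop 1] with k hk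
        simp only [φ]
        rw [max_eq_right hpos.le, max_eq_left (by linarith)]
    simpa using h1.add h2

/-! ### Multiplicative classes of functions: measurability and uniqueness of laws -/

section Multiplicative

variable {Ω Y : Type*} [MeasurableSpace Ω] [mY : MeasurableSpace Y]

/-- A family of probability measures is measurable if it integrates measurably the members of a
multiplicative class of `[0, 1]`-valued functions that generates the sigma-algebra. -/
theorem measurable_of_measurable_lintegral_multiplicative {T : Ω → Measure Y}
    [∀ a, IsProbabilityMeasure (T a)] {M : Set (Y → ℝ)} (hmeas : ∀ g ∈ M, Measurable g)
    (hIcc : ∀ g ∈ M, ∀ y, g y ∈ Set.Icc (0 : ℝ) 1) (hone : (1 : Y → ℝ) ∈ M)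
    (hmul : ∀ g ∈ M, ∀ h ∈ M, g * h ∈ M)
    (hgen : mY ≤ ⨆ g ∈ M, MeasurableSpace.comap g (borel ℝ))
    (hint : ∀ g ∈ M, Measurable fun a => ∫⁻ y, ENNReal.ofReal (g y) ∂T a) :
    Measurable T := by
  -- Every g in M is carried as a weight. A further cut by {g ≥ c} is then a limit of polynomials in
  -- g times a weight, and multiplicativity keeps each monomial in M.
  let 𝒟 : Set (Set Y) := {D | MeasurableSet D ∧ ∀ g ∈ M,
    Measurable fun a => ∫ y, D.indicator g y ∂T a}
  have hpow : ∀ g ∈ M, ∀ h ∈ M, ∀ k : ℕ, g * h ^ k ∈ M := by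
    intro g hg h hh k
    induction k with
    | zero => simpa using hg
    | succ k ih => rw [pow_succ, ← mul_assoc]; exact hmul _ ih _ hh
  have huniv : Set.univ ∈ 𝒟 := by
    refine ⟨MeasurableSet.univ, fun g hg => ?_⟩
    simp only [Set.indicator_univ]
    have : (fun a => ∫ y, g y ∂T a) = fun a => (∫⁻ y, ENNReal.ofReal (g y) ∂T a).toReal := by
      ext a
      exact integral_eq_lintegral_of_nonneg_ae (ae_of_all _ fun y => (hIcc g hg y).1)
        (hmeas g hg).aestronglyMeasurable
    rw [this]
    exact (hint g hg).ennreal_toReal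
  have hstep : ∀ D ∈ 𝒟, ∀ g ∈ M, ∀ c : ℝ, D ∩ g ⁻¹' Set.Ici c ∈ 𝒟 := by
    intro D hD g hg c
    refine ⟨hD.1.inter (hmeas g hg measurableSet_Ici), fun h hh => ?_⟩
    obtain ⟨p, hp2, hp⟩ := exists_polynomial_tendsto_indicator c
    have hbd : ∀ f ∈ M, ∀ y, |D.indicator f y| ≤ 1 := fun f hf y => by
      by_cases hy : y ∈ D
      · rw [Set.indicator_of_mem hy, abs_of_nonneg (hIcc f hf y).1]; exact (hIcc f hf y).2
      · simp [hy]
    have hpm : ∀ k, Measurable fun y => (p k).eval (g y) := fun k =>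
      (p k).continuous.measurable.comp (hmeas g hg)
    refine measurable_of_tendsto_metrizable
      (f := fun k a => ∫ y, D.indicator h y * (p k).eval (g y) ∂T a) (fun k => ?_)
      (tendsto_pi_nhds.2 fun a => ?_)
    · have : ∀ a, ∫ y, D.indicator h y * (p k).eval (g y) ∂T a =
          ∑ j ∈ (p k).support, (p k).coeff j * ∫ y, D.indicator (h * g ^ j) y ∂T a := by
        intro a
        rw [← Finset.sum_congr rfl fun j _ => integral_const_mul _ _, ← integral_finsetSum]
        · refine integral_congr_ae (ae_of_all _ fun y => ?_)
          simp only [Polynomial.eval_eq_sum, Polynomial.sum, Finset.mul_sum]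
          refine Finset.sum_congr rfl fun j _ => ?_
          by_cases hy : y ∈ D
          · simp [hy]; ring
          · simp [hy]
        · intro j _
          refine Integrable.const_mul (Integrable.of_bound (C := 1)
            (((hmeas _ (hpow h hh g hg j)).indicator hD.1).aestronglyMeasurable)
            (ae_of_all _ fun y => ?_)) _
          exact hbd _ (hpow h hh g hg j) y
      simp only [this]
      exact Finset.measurable_sum _ fun j _ => (hD.2 _ (hpow h hh g hg j)).const_mul _
    · refine tendsto_integral_of_dominated_convergence (fun _ => 2)
        (fun k => (((hmeas h hh).indicator hD.1).mul (hpm k)).aestronglyMeasurable)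
        (integrable_const _) (fun k => ae_of_all _ fun y => ?_) (ae_of_all _ fun y => ?_)
      · rw [norm_mul]
        have h1 := hbd h hh y
        have h2 := hp2 k _ (hIcc g hg y)
        rw [Real.norm_eq_abs, Real.norm_eq_abs]
        nlinarith [abs_nonneg (D.indicator h y), abs_nonneg ((p k).eval (g y))]
      · have := (hp _ (hIcc g hg y)).const_mul (D.indicator h y)
        convert this using 2
        by_cases hy : y ∈ D <;> by_cases hc : c ≤ g y <;> simp [Set.indicator, hy, hc]
  -- 𝒟 is not known to be closed under intersections. The sets that act on 𝒟 by intersection are,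
  -- and they contain the generating sets {g ≥ c}.
  let S : Set (Set Y) := {s | MeasurableSet s ∧ ∀ D ∈ 𝒟, D ∩ s ∈ 𝒟}
  refine Measurable.measure_of_isPiSystem_of_isProbabilityMeasure (S := S)
    (le_antisymm (hgen.trans ?_) (MeasurableSpace.generateFrom_le fun s hs => hs.1)) ?_ ?_
  · refine iSup₂_le fun g hg => ?_
    rw [borel_eq_generateFrom_Ici, MeasurableSpace.comap_generateFrom]
    refine MeasurableSpace.generateFrom_mono ?_
    rintro _ ⟨_, ⟨c, rfl⟩, rfl⟩
    exact ⟨hmeas g hg measurableSet_Ici, fun D hD => hstep D hD g hg c⟩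
  · intro s hs t ht _
    refine ⟨hs.1.inter ht.1, fun D hD => ?_⟩
    rw [← Set.inter_assoc]
    exact ht.2 _ (hs.2 D hD)
  · intro s hs
    have h1 := (hs.2 _ huniv).2 1 hone
    rw [Set.univ_inter] at h1
    have : (fun a => T a s) = fun a => ENNReal.ofReal (∫ y, s.indicator 1 y ∂T a) := by
      ext a
      rw [integral_indicator_one hs.1, ofReal_measureReal]
    rw [this]
    exact h1.ennreal_ofReal

/-- Two probability measures agree if they integrate equally the members of a multiplicative class
of `[0, 1]`-valued functions that generates the sigma-algebra. -/
theorem ext_of_lintegral_multiplicative {μ ν : Measure Y} [IsProbabilityMeasure μ]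
    [IsProbabilityMeasure ν] {M : Set (Y → ℝ)} (hmeas : ∀ g ∈ M, Measurable g)
    (hIcc : ∀ g ∈ M, ∀ y, g y ∈ Set.Icc (0 : ℝ) 1) (hone : (1 : Y → ℝ) ∈ M)
    (hmul : ∀ g ∈ M, ∀ h ∈ M, g * h ∈ M)
    (hgen : mY ≤ ⨆ g ∈ M, MeasurableSpace.comap g (borel ℝ))
    (hint : ∀ g ∈ M, ∫⁻ y, ENNReal.ofReal (g y) ∂μ = ∫⁻ y, ENNReal.ofReal (g y) ∂ν) :
    μ = ν := by
  -- A family over `Bool` that is measurable for the trivial sigma-algebra is constant, so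
  -- uniqueness is a case of the measurability criterion.
  let T : Bool → Measure Y := fun b => cond b μ ν
  have : ∀ b, IsProbabilityMeasure (T b) := by rintro (_ | _) <;> assumption
  have hT : @Measurable Bool _ ⊥ _ T := by
    refine @measurable_of_measurable_lintegral_multiplicative _ _ ⊥ _ T _ M hmeas hIcc hone hmul
      hgen fun g hg => ?_
    have : (fun a => ∫⁻ y, ENNReal.ofReal (g y) ∂T a) =
        fun _ => ∫⁻ y, ENNReal.ofReal (g y) ∂ν := by
      ext b
      cases b
      · rfl
      · exact hint g hg
    rw [this]
    exact @measurable_const _ _ _ ⊥ _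
  ext s hs
  have h1 : @Measurable Bool _ ⊥ _ fun b => T b s :=
    @Measurable.comp _ _ _ ⊥ _ _ _ _ (Measure.measurable_coe hs) hT
  have h2 := h1 (measurableSet_singleton (ν s))
  rcases MeasurableSpace.measurableSet_bot_iff.1 h2 with h | h
  · have : false ∈ (fun b => T b s) ⁻¹' {ν s} := rfl
    rw [h] at this
    exact this.elim
  · have : true ∈ (fun b => T b s) ⁻¹' {ν s} := by rw [h]; trivial
    exact this

end Multiplicative

/-! ### Structure of locally finite point measures -/

section Structure

variable {X : Type*} [MetricSpace X] [MeasurableSpace X] [BorelSpace X]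

/-- Reduces conditions over all bounded sets to countably many, as measurability requires. Balls of
integer radius serve; the empty space has no centre and is separate. -/
theorem exists_windows (X : Type*) [MetricSpace X] [MeasurableSpace X] [BorelSpace X] :
    ∃ W : ℕ → Set X, (∀ n, MeasurableSet (W n)) ∧ (∀ n, Bornology.IsBounded (W n)) ∧
      Monotone W ∧ ∀ B : Set X, Bornology.IsBounded B → ∃ n, B ⊆ W n := by
  rcases isEmpty_or_nonempty X with h | ⟨⟨x⟩⟩
  · exact ⟨fun _ => ∅, fun _ => MeasurableSet.empty, fun _ => Bornology.isBounded_empty,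
      fun _ _ _ => le_rfl, fun B _ => ⟨0, by simp [Set.eq_empty_of_isEmpty B]⟩⟩
  · refine ⟨fun n => Metric.closedBall x n, fun n => measurableSet_closedBall,
      fun n => Metric.isBounded_closedBall,
      fun m n h => Metric.closedBall_subset_closedBall (by exact_mod_cast h), fun B hB => ?_⟩
    obtain ⟨r, hr⟩ := hB.subset_closedBall x
    obtain ⟨n, hn⟩ := exists_nat_ge r
    exact ⟨n, hr.trans (Metric.closedBall_subset_closedBall hn)⟩

/-- An exhaustion of the space by bounded Borel sets that absorbs every bounded set. -/
noncomputable def window (X : Type*) [MetricSpace X] [MeasurableSpace X] [BorelSpace X] :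
    ℕ → Set X := (exists_windows X).choose

theorem measurableSet_window (n : ℕ) : MeasurableSet (window X n) :=
  (exists_windows X).choose_spec.1 n

theorem isBounded_window (n : ℕ) : Bornology.IsBounded (window X n) :=
  (exists_windows X).choose_spec.2.1 n

theorem monotone_window : Monotone (window X) := (exists_windows X).choose_spec.2.2.1

theorem exists_subset_window {B : Set X} (hB : Bornology.IsBounded B) : ∃ n, B ⊆ window X n :=
  (exists_windows X).choose_spec.2.2.2 B hB

theorem iUnion_window : ⋃ n, window X n = Set.univ := by
  refine Set.eq_univ_of_forall fun x => ?_
  obtain ⟨n, hn⟩ := exists_subset_window (Bornology.isBounded_singleton (x := x))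
  exact Set.mem_iUnion.2 ⟨n, hn rfl⟩

theorem measure_eq_iSup_window (μ : Measure X) (B : Set X) :
    μ B = ⨆ n, μ (B ∩ window X n) := by
  rw [← Monotone.measure_iUnion, ← Set.inter_iUnion, iUnion_window, Set.inter_univ]
  exact fun m n h => Set.inter_subset_inter_right _ (monotone_window h)

theorem ext_of_bounded {μ ν : Measure X}
    (h : ∀ B, MeasurableSet B → Bornology.IsBounded B → μ B = ν B) : μ = ν := by
  ext B hB
  rw [measure_eq_iSup_window μ, measure_eq_iSup_window ν]
  exact iSup_congr fun n => h _ (hB.inter (measurableSet_window n))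
    ((isBounded_window n).subset Set.inter_subset_right)

omit [BorelSpace X] in
theorem measurable_apply {B : Set X} (hB : MeasurableSet B) :
    Measurable fun μ : PointMeasure X => μ.1 B :=
  (Measure.measurable_coe hB).comp measurable_subtype_coe

theorem measurable_pointMeasure {Ω : Type*} [MeasurableSpace Ω] {f : Ω → PointMeasure X}
    (h : ∀ B, MeasurableSet B → Bornology.IsBounded B → Measurable fun a => (f a).1 B) :
    Measurable f := by
  refine Measurable.subtype_mk (f := fun a => (f a).1)
    (Measure.measurable_of_measurable_coe _ fun B hB => ?_)
  have : (fun a => (f a).1 B) = fun a => ⨆ n, (f a).1 (B ∩ window X n) := by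
    ext a; exact measure_eq_iSup_window _ _
  rw [this]
  exact Measurable.iSup fun n => h _ (hB.inter (measurableSet_window n))
    ((isBounded_window n).subset Set.inter_subset_right)

theorem PointMeasure.apply_lt_top (μ : PointMeasure X) {B : Set X}
    (hb : Bornology.IsBounded B) : μ.1 B < ∞ := by
  obtain ⟨n, hn⟩ := exists_subset_window hb
  obtain ⟨k, hk⟩ := μ.2 _ (measurableSet_window n) (isBounded_window n)
  exact (measure_mono hn).trans_lt (by rw [hk]; exact ENNReal.natCast_lt_top k)

/-- A finite sum of natural numbers has only finitely many nonzero terms, so finiteness on bounded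
sets already forces integer values. The criterion involves countably many evaluations. -/
theorem isPointMeasure_sum_iff {ι : Type*} (η : ι → PointMeasure X) :
    IsPointMeasure (Measure.sum fun i => (η i).1) ↔
      ∀ n, Measure.sum (fun i => (η i).1) (window X n) < ∞ := by
  refine ⟨fun h n => PointMeasure.apply_lt_top ⟨_, h⟩ (isBounded_window n), fun h B hB hb => ?_⟩
  obtain ⟨n, hn⟩ := exists_subset_window hb
  have hlt := (measure_mono hn).trans_lt (h n)
  choose k hk using fun i => (η i).2 B hB hb
  rw [Measure.sum_apply _ hB] at hlt ⊢
  simp only [hk] at hlt ⊢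
  have hfin : {i | (1 : ℝ≥0∞) ≤ k i}.Finite :=
    ENNReal.finite_const_le_of_tsum_ne_top hlt.ne one_ne_zero
  refine ⟨∑ i ∈ hfin.toFinset, k i, ?_⟩
  rw [tsum_eq_sum (s := hfin.toFinset)]
  · push_cast; rfl
  · intro i hi
    have hi' : ¬ (1 : ℝ≥0∞) ≤ k i := by simpa using hi
    norm_cast at hi' ⊢
    omega

omit [BorelSpace X] in
theorem superposition_val {ι : Type*} {η : ι → PointMeasure X}
    (h : IsPointMeasure (Measure.sum fun i => (η i).1)) :
    (superposition η).1 = Measure.sum fun i => (η i).1 := by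
  rw [superposition, dif_pos h]

theorem measurable_superposition {ι : Type*} [Countable ι] :
    Measurable (superposition : (ι → PointMeasure X) → PointMeasure X) := by
  classical
  have hs : ∀ B, MeasurableSet B →
      Measurable fun η : ι → PointMeasure X => Measure.sum (fun i => (η i).1) B := by
    intro B hB
    simp only [Measure.sum_apply _ hB]
    exact Measurable.tsum fun i => (measurable_apply hB).comp (measurable_pi_apply i)
  have hset : MeasurableSet {η : ι → PointMeasure X |
      IsPointMeasure (Measure.sum fun i => (η i).1)} := by
    simp only [isPointMeasure_sum_iff, Set.ofPred_forall]
    exact MeasurableSet.iInter fun n =>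
      measurableSet_lt (hs _ (measurableSet_window n)) measurable_const
  refine measurable_pointMeasure fun B hB _ => ?_
  have : (fun η : ι → PointMeasure X => (superposition η).1 B) = fun η =>
      if IsPointMeasure (Measure.sum fun i => (η i).1) then Measure.sum (fun i => (η i).1) B
      else 0 := by
    ext η
    by_cases h : IsPointMeasure (Measure.sum fun i => (η i).1)
    · rw [superposition_val h, if_pos h]
    · rw [superposition, dif_neg h, if_neg h]; simp [emptyConfig]
  rw [this]
  exact Measurable.ite hset (hs B hB) measurable_const

theorem sigmaFinite_pointMeasure (μ : PointMeasure X) : SigmaFinite μ.1 :=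
  ⟨⟨⟨window X, fun _ => trivial, fun n => μ.apply_lt_top (isBounded_window n), iUnion_window⟩⟩⟩

theorem countable_atoms (μ : PointMeasure X) : {x | 0 < μ.1 {x}}.Countable := by
  have := sigmaFinite_pointMeasure μ
  exact Measure.countable_meas_pos_of_disjoint_iUnion (μ := μ.1) (As := fun x : X => {x})
    (fun x => measurableSet_singleton x) fun x y h => by simpa using h

variable [SecondCountableTopology X]

/-- A locally finite integer-valued measure on a separable metric space is purely atomic. -/
theorem measure_compl_atoms (μ : PointMeasure X) : μ.1 {x | 0 < μ.1 {x}}ᶜ = 0 := by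
  -- Around a point of mass 0 the masses of shrinking balls tend to 0; being integers, they are
  -- eventually 0.
  refine measure_null_of_locally_null _ fun x hx => ?_
  have hx0 : μ.1 {x} = 0 := by simpa using hx
  have hfin : ∃ n : ℕ, μ.1 (Metric.closedBall x (1 / ((n : ℝ) + 1))) ≠ ∞ :=
    ⟨0, (μ.apply_lt_top Metric.isBounded_closedBall).ne⟩
  have hanti : Antitone fun n : ℕ => Metric.closedBall x (1 / ((n : ℝ) + 1)) := fun m n h =>
    Metric.closedBall_subset_closedBall (Nat.one_div_le_one_div h)
  have hlim := tendsto_measure_iInter_atTop (μ := μ.1)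
    (fun n : ℕ => (measurableSet_closedBall (x := x) (ε := 1 / ((n : ℝ) + 1))).nullMeasurableSet)
    hanti hfin
  have hinter : ⋂ n : ℕ, Metric.closedBall x (1 / ((n : ℝ) + 1)) = {x} := by
    ext y
    simp only [Set.mem_iInter, Metric.mem_closedBall, Set.mem_singleton_iff]
    refine ⟨fun h => ?_, fun h n => by rw [h, dist_self]; positivity⟩
    exact dist_le_zero.1 (ge_of_tendsto' tendsto_one_div_add_atTop_nhds_zero_nat h)
  rw [hinter, hx0] at hlim
  obtain ⟨n, hn⟩ := (hlim.eventually_lt_const (zero_lt_one)).exists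
  obtain ⟨k, hk⟩ := μ.2 (Metric.closedBall x (1 / ((n : ℝ) + 1))) measurableSet_closedBall
    Metric.isBounded_closedBall
  refine ⟨Metric.closedBall x (1 / ((n : ℝ) + 1)), mem_nhdsWithin_of_mem_nhds (Metric.closedBall_mem_nhds x (by positivity)), ?_⟩
  rw [Function.comp_apply, hk] at hn
  rw [hk]
  norm_cast at hn ⊢
  omega

theorem measure_eq_tsum_atoms (μ : PointMeasure X) {B : Set X} (hB : MeasurableSet B) :
    μ.1 B = ∑' x : {x | 0 < μ.1 {x}}, μ.1 {x.1} * Measure.dirac x.1 B := by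
  have hc := countable_atoms μ
  have h1 : μ.1 B = μ.1 (⋃ x ∈ {x | 0 < μ.1 {x}}, {x} ∩ B) := by
    rw [← Set.iUnion₂_inter, Set.biUnion_of_singleton, Set.inter_comm]
    exact (measure_inter_conull (measure_compl_atoms μ)).symm
  rw [h1, measure_biUnion hc]
  · refine tsum_congr fun x => ?_
    rw [Measure.dirac_apply' _ hB]
    by_cases hx : x.1 ∈ B
    · rw [Set.inter_eq_left.2 (Set.singleton_subset_iff.2 hx)]; simp [hx]
    · rw [Set.singleton_inter_eq_empty.2 hx]; simp [hx]
  · intro x _ y _ hxy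
    exact (Set.disjoint_singleton.2 hxy).mono Set.inter_subset_left Set.inter_subset_left
  · exact fun x _ => (measurableSet_singleton x).inter hB

theorem exists_atom_mass (μ : PointMeasure X) (x : X) : ∃ k : ℕ, μ.1 {x} = k :=
  μ.2 _ (measurableSet_singleton x) Bornology.isBounded_singleton

/-- By pure atomicity only the atoms count, and the fibre of `Points μ` over an atom x has μ {x}
elements. -/
theorem sum_dirac_points (μ : PointMeasure X) :
    Measure.sum (fun p : Points μ => Measure.dirac p.1.1) = μ.1 := by
  ext B hB
  rw [Measure.sum_apply _ hB, measure_eq_tsum_atoms μ hB]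
  let e : Points μ ≃ Σ x : {x | 0 < μ.1 {x}}, {k : ℕ // (k : ℝ≥0∞) < μ.1 {x.1}} :=
    { toFun := fun p => ⟨⟨p.1.1, bot_le.trans_lt p.2⟩, ⟨p.1.2, p.2⟩⟩
      invFun := fun p => ⟨(p.1.1, p.2.1), p.2.2⟩
      left_inv := fun p => rfl
      right_inv := fun p => rfl }
  rw [← e.symm.tsum_eq, ENNReal.tsum_sigma']
  refine tsum_congr fun x => ?_
  obtain ⟨k, hk⟩ := exists_atom_mass μ x.1
  have hcard : ∑' _ : {j : ℕ // (j : ℝ≥0∞) < μ.1 {x.1}}, (1 : ℝ≥0∞) = μ.1 {x.1} := by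
    have hset : {j : ℕ | (j : ℝ≥0∞) < (k : ℝ≥0∞)} = (Finset.range k : Set ℕ) := by
      ext j; simp
    have := ENNReal.tsum_set_one {j : ℕ | (j : ℝ≥0∞) < (k : ℝ≥0∞)}
    rw [hset, Set.encard_coe_eq_coe_finsetCard, ← hset] at this
    rw [hk]
    exact this.trans (by simp)
  change ∑' _ : {j : ℕ // (j : ℝ≥0∞) < μ.1 {x.1}}, Measure.dirac x.1 B = _
  conv_rhs => rw [← hcard, ← ENNReal.tsum_mul_right]
  simp only [one_mul]

omit [SecondCountableTopology X] in
theorem countable_points (μ : PointMeasure X) : Countable (Points μ) := by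
  have := (countable_atoms μ).to_subtype
  refine Function.Injective.countable
    (f := fun p : Points μ => ((⟨p.1.1, bot_le.trans_lt p.2⟩ : {x | 0 < μ.1 {x}}), p.1.2)) ?_
  rintro ⟨⟨x, j⟩, hp⟩ ⟨⟨y, k⟩, hq⟩ h
  simpa using h

theorem finite_points (μ : PointMeasure X) {B : Set X} (hb : Bornology.IsBounded B) :
    {p : Points μ | p.1.1 ∈ B}.Finite := by
  obtain ⟨n, hn⟩ := exists_subset_window hb
  have h := μ.apply_lt_top (isBounded_window n)
  rw [← sum_dirac_points μ, Measure.sum_apply _ (measurableSet_window n)] at h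
  refine (ENNReal.finite_const_le_of_tsum_ne_top h.ne one_ne_zero).subset fun p hp => ?_
  simp [Measure.dirac_apply' _ (measurableSet_window n), hn hp]

theorem lintegral_eq_tsum_points (μ : PointMeasure X) {f : X → ℝ≥0∞} (hf : Measurable f) :
    ∫⁻ x, f x ∂μ.1 = ∑' p : Points μ, f p.1.1 := by
  conv_lhs => rw [← sum_dirac_points μ]
  rw [lintegral_sum_measure]
  exact tsum_congr fun p => lintegral_dirac' _ hf

/-- Expresses domination by countably many evaluations of κ, so that it is a measurable condition on
κ. -/
theorem le_iff_atoms (μ κ : PointMeasure X) :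
    κ.1 ≤ μ.1 ↔ κ.1 {x | 0 < μ.1 {x}}ᶜ = 0 ∧ ∀ x : {x | 0 < μ.1 {x}}, κ.1 {x.1} ≤ μ.1 {x.1} := by
  refine ⟨fun h => ⟨le_antisymm ((h _).trans (measure_compl_atoms μ).le) bot_le, fun x => h _⟩,
    fun ⟨h0, h⟩ => ?_⟩
  have hle : ∀ x, κ.1 {x} ≤ μ.1 {x} := by
    intro x
    by_cases hx : 0 < μ.1 {x}
    · exact h ⟨x, hx⟩
    · have : κ.1 {x} = 0 := measure_mono_null (Set.singleton_subset_iff.2 hx) h0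
      rw [this]; exact bot_le
  refine Measure.le_iff.2 fun B hB => ?_
  rw [measure_eq_tsum_atoms κ hB]
  calc ∑' x : {x | 0 < κ.1 {x}}, κ.1 {x.1} * Measure.dirac x.1 B
      ≤ ∑' x : {x | 0 < κ.1 {x}}, μ.1 ({x.1} ∩ B) := by
        refine ENNReal.tsum_le_tsum fun x => ?_
        rw [Measure.dirac_apply' _ hB]
        by_cases hx : x.1 ∈ B
        · rw [Set.inter_eq_left.2 (Set.singleton_subset_iff.2 hx)]; simpa [hx] using hle x
        · simp [hx]
    _ = μ.1 (⋃ x ∈ {x | 0 < κ.1 {x}}, {x} ∩ B) := by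
        rw [measure_biUnion (countable_atoms κ)]
        · intro x _ y _ hxy
          exact (Set.disjoint_singleton.2 hxy).mono Set.inter_subset_left Set.inter_subset_left
        · exact fun x _ => (measurableSet_singleton x).inter hB
    _ ≤ μ.1 B := measure_mono (Set.iUnion₂_subset fun x _ => Set.inter_subset_right)

omit [SecondCountableTopology X] in
theorem residual_apply {μ κ : PointMeasure X} (h : κ.1 ≤ μ.1) {B : Set X} (hB : MeasurableSet B)
    (hb : Bornology.IsBounded B) : (residual μ κ).1 B = μ.1 B - κ.1 B := by
  rw [residual, dif_pos h]
  have hfin : IsFiniteMeasure (κ.1.restrict B) :=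
    ⟨by simpa using κ.apply_lt_top hb⟩
  change (μ.1 - κ.1) B = _
  rw [← Measure.restrict_apply_self (μ.1 - κ.1) B,
    Measure.restrict_sub_eq_restrict_sub_restrict hB,
    Measure.sub_apply hB (Measure.restrict_mono le_rfl h),
    Measure.restrict_apply_self, Measure.restrict_apply_self]

/-- Measurability in κ for fixed μ suffices: the dependence of iterated thinning on μ is later
controlled through integrals of test functionals. -/
theorem measurable_residual (μ : PointMeasure X) : Measurable (residual μ) := by
  classical
  have hset : MeasurableSet {κ : PointMeasure X | κ.1 ≤ μ.1} := by
    simp only [le_iff_atoms, Set.ofPred_and, Set.ofPred_forall]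
    have := (countable_atoms μ).to_subtype
    refine MeasurableSet.inter ?_ (MeasurableSet.iInter fun x => ?_)
    · exact measurable_apply (countable_atoms μ).measurableSet.compl (measurableSet_singleton 0)
    · exact measurableSet_le (measurable_apply (measurableSet_singleton _)) measurable_const
  refine measurable_pointMeasure fun B hB hb => ?_
  have : (fun κ : PointMeasure X => (residual μ κ).1 B) = fun κ =>
      if κ.1 ≤ μ.1 then μ.1 B - κ.1 B else 0 := by
    ext κ
    by_cases h : κ.1 ≤ μ.1
    · rw [if_pos h, residual_apply h hB hb]
    · rw [residual, dif_neg h, if_neg h]; simp [emptyConfig]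
  rw [this]
  exact Measurable.ite hset (measurable_const.sub (measurable_apply hB)) measurable_const

end Structure

/-! ### Test functions and products over points -/

section TestFunctions

variable {X : Type*} [MetricSpace X] [MeasurableSpace X]

/-- Simple functions with values in `(0, 1]` that are `1` off a bounded set. -/
structure IsTest (u : X → ℝ) : Prop where
  measurable : Measurable u
  finite_range : (Set.range u).Finite
  pos : ∀ x, 0 < u x
  le_one : ∀ x, u x ≤ 1
  bounded : Bornology.IsBounded {x | u x ≠ 1}

theorem IsTest.one : IsTest (1 : X → ℝ) where
  measurable := measurable_one
  finite_range := (Set.finite_singleton 1).subset (by rintro _ ⟨x, rfl⟩; rfl)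
  pos _ := zero_lt_one
  le_one _ := le_rfl
  bounded := by simp

theorem IsTest.mul {u v : X → ℝ} (hu : IsTest u) (hv : IsTest v) : IsTest (u * v) where
  measurable := hu.measurable.mul hv.measurable
  finite_range := (hu.finite_range.image2 (· * ·) hv.finite_range).subset (by
    rintro _ ⟨x, rfl⟩; exact ⟨_, ⟨x, rfl⟩, _, ⟨x, rfl⟩, rfl⟩)
  pos x := mul_pos (hu.pos x) (hv.pos x)
  le_one x := mul_le_one₀ (hu.le_one x) (hv.pos x).le (hv.le_one x)
  bounded := (hu.bounded.union hv.bounded).subset fun x hx => by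
    by_contra h
    simp only [Set.mem_union, Set.mem_ofPred_eq, not_or, not_not] at h
    exact hx (by simp [h])

theorem IsTest.convex {u v : X → ℝ} (hu : IsTest u) (hv : IsTest v) {s : ℝ} (h0 : 0 ≤ s)
    (h1 : s ≤ 1) : IsTest fun x => s * u x + (1 - s) * v x where
  measurable := (hu.measurable.const_mul _).add (hv.measurable.const_mul _)
  finite_range := (hu.finite_range.image2 (fun a b => s * a + (1 - s) * b) hv.finite_range).subset
    (by rintro _ ⟨x, rfl⟩; exact ⟨_, ⟨x, rfl⟩, _, ⟨x, rfl⟩, rfl⟩)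
  pos x := by
    rcases h0.eq_or_lt with rfl | h
    · simpa using hv.pos x
    · have := mul_pos h (hu.pos x)
      have := mul_nonneg (sub_nonneg.2 h1) (hv.pos x).le
      linarith
  le_one x := by nlinarith [hu.le_one x, hv.le_one x]
  bounded := (hu.bounded.union hv.bounded).subset fun x hx => by
    by_contra h
    simp only [Set.mem_union, Set.mem_ofPred_eq, not_or, not_not] at h
    exact hx (by simp [h])

open scoped Classical in
/-- The test function that is `c` on `B` and `1` elsewhere. -/
theorem IsTest.ite {B : Set X} (hB : MeasurableSet B) (hb : Bornology.IsBounded B) {c : ℝ}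
    (h0 : 0 < c) (h1 : c ≤ 1) : IsTest fun x => if x ∈ B then c else 1 where
  measurable := Measurable.ite hB measurable_const measurable_const
  finite_range := (Set.toFinite {c, 1}).subset (by rintro _ ⟨x, rfl⟩; dsimp only; split_ifs <;> simp)
  pos x := by split_ifs <;> linarith
  le_one x := by split_ifs <;> linarith
  bounded := hb.subset fun x hx => by
    by_contra h
    exact hx (by simp [h])

/-- The product of `u` over the points of `μ`. -/
noncomputable def pointProd (u : X → ℝ) (μ : PointMeasure X) : ℝ :=
  -- Writing the product through an integral makes it measurable in μ without enumerating points.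
  -- For test functions the integral is finite, so `toReal` loses nothing.
  Real.exp (-(∫⁻ x, ENNReal.ofReal (-Real.log (u x)) ∂μ.1).toReal)

theorem pointProd_mem_Icc (u : X → ℝ) (μ : PointMeasure X) :
    pointProd u μ ∈ Set.Icc (0 : ℝ) 1 :=
  ⟨(Real.exp_pos _).le, Real.exp_le_one_iff.2 (neg_nonpos.2 ENNReal.toReal_nonneg)⟩

theorem measurable_pointProd {u : X → ℝ} (hu : IsTest u) : Measurable (pointProd u) :=
  Real.measurable_exp.comp (((Measure.measurable_lintegral
    hu.measurable.log.neg.ennreal_ofReal).comp measurable_subtype_coe).ennreal_toReal.neg)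

theorem pointProd_one (μ : PointMeasure X) : pointProd (1 : X → ℝ) μ = 1 := by
  simp [pointProd]

variable [BorelSpace X] [SecondCountableTopology X]

/-- The sub-configuration of `μ` formed by the points selected by `b`. -/
noncomputable def select (μ : PointMeasure X) (b : Points μ → Bool) : PointMeasure X :=
  superposition fun p => cond (b p) (pointConfig p.1.1) (emptyConfig X)

/-- The selected points are dominated by μ, so the default branch of `superposition` never occurs.
-/
theorem select_val (μ : PointMeasure X) (b : Points μ → Bool) :
    (select μ b).1 = Measure.sum fun p : Points μ => cond (b p) (Measure.dirac p.1.1) 0 := by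
  have hval : ∀ p : Points μ, (cond (b p) (pointConfig p.1.1) (emptyConfig X)).1 =
      cond (b p) (Measure.dirac p.1.1) 0 := fun p => by cases b p <;> rfl
  rw [select, superposition_val]
  · simp only [hval]
  · refine (isPointMeasure_sum_iff _).2 fun n => ?_
    refine lt_of_le_of_lt ?_ (μ.apply_lt_top (isBounded_window n))
    simp only [hval]
    conv_rhs => rw [← sum_dirac_points μ]
    rw [Measure.sum_apply _ (measurableSet_window n), Measure.sum_apply _ (measurableSet_window n)]
    refine ENNReal.tsum_le_tsum fun p => ?_
    cases b p <;> simp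

theorem select_true (μ : PointMeasure X) : select μ (fun _ => true) = μ :=
  Subtype.ext ((select_val μ _).trans (sum_dirac_points μ))

theorem select_add_select_not (μ : PointMeasure X) (b : Points μ → Bool) :
    (select μ b).1 + (select μ fun p => !b p).1 = μ.1 := by
  conv_rhs => rw [← sum_dirac_points μ]
  rw [select_val, select_val, Measure.sum_add_sum]
  congr 1
  ext1 p
  cases b p <;> simp

theorem residual_select (μ : PointMeasure X) (b : Points μ → Bool) :
    residual μ (select μ b) = select μ fun p => !b p := by
  have h := select_add_select_not μ b
  have hle : (select μ b).1 ≤ μ.1 := by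
    conv_rhs => rw [← h]
    exact Measure.le_add_right le_rfl
  refine Subtype.ext (ext_of_bounded fun B hB hb => ?_)
  rw [residual_apply hle hB hb]
  conv_lhs => rw [← h]
  rw [Measure.add_apply, ENNReal.add_sub_cancel_left ((select μ b).apply_lt_top hb).ne]

/-- Points where u is 1 contribute nothing. The finite set S is left free so that several test
functions can share one. -/
theorem pointProd_select {u : X → ℝ} (hu : IsTest u) (μ : PointMeasure X) (b : Points μ → Bool)
    {S : Finset (Points μ)} (hS : ∀ p, u p.1.1 ≠ 1 → p ∈ S) :
    pointProd u (select μ b) = ∏ p ∈ S, cond (b p) (u p.1.1) 1 := by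
  have hlog : ∀ x, 0 ≤ -Real.log (u x) := fun x =>
    neg_nonneg.2 (Real.log_nonpos (hu.pos x).le (hu.le_one x))
  have h1 : ∫⁻ x, ENNReal.ofReal (-Real.log (u x)) ∂(select μ b).1 =
      ∑ p ∈ S, ENNReal.ofReal (cond (b p) (-Real.log (u p.1.1)) 0) := by
    rw [select_val, lintegral_sum_measure]
    have : ∀ p : Points μ, ∫⁻ x, ENNReal.ofReal (-Real.log (u x))
        ∂(cond (b p) (Measure.dirac p.1.1) 0) =
        ENNReal.ofReal (cond (b p) (-Real.log (u p.1.1)) 0) := fun p => by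
      cases b p
      · simp
      · exact lintegral_dirac' _ hu.measurable.log.neg.ennreal_ofReal
    simp only [this]
    refine tsum_eq_sum fun p hp => ?_
    have : u p.1.1 = 1 := by by_contra h; exact hp (hS p h)
    cases b p <;> simp [this]
  rw [pointProd, h1, ← ENNReal.ofReal_sum_of_nonneg, ENNReal.toReal_ofReal, ← Finset.sum_neg_distrib,
    Real.exp_sum]
  · refine Finset.prod_congr rfl fun p _ => ?_
    cases b p
    · simp
    · simp [Real.exp_log (hu.pos _)]
  · refine Finset.sum_nonneg fun p _ => ?_
    cases b p
    · exact le_rfl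
    · exact hlog _
  · intro p _
    cases b p
    · exact le_rfl
    · exact hlog _

theorem pointProd_eq_prod {u : X → ℝ} (hu : IsTest u) (μ : PointMeasure X)
    {S : Finset (Points μ)} (hS : ∀ p, u p.1.1 ≠ 1 → p ∈ S) :
    pointProd u μ = ∏ p ∈ S, u p.1.1 := by
  conv_lhs => rw [← select_true μ]
  rw [pointProd_select hu μ _ hS]
  rfl

theorem exists_finset_points {u : X → ℝ} (hu : IsTest u) (μ : PointMeasure X) :
    ∃ S : Finset (Points μ), ∀ p, u p.1.1 ≠ 1 → p ∈ S :=
  ⟨(finite_points μ hu.bounded).toFinset, fun p hp => by simpa using hp⟩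

theorem pointProd_mul {u v : X → ℝ} (hu : IsTest u) (hv : IsTest v) (μ : PointMeasure X) :
    pointProd (u * v) μ = pointProd u μ * pointProd v μ := by
  classical
  obtain ⟨S, hS⟩ := exists_finset_points hu μ
  obtain ⟨S', hS'⟩ := exists_finset_points hv μ
  have h1 : ∀ p : Points μ, u p.1.1 ≠ 1 → p ∈ S ∪ S' := fun p hp => by simp [hS p hp]
  have h2 : ∀ p : Points μ, v p.1.1 ≠ 1 → p ∈ S ∪ S' := fun p hp => by simp [hS' p hp]
  rw [pointProd_eq_prod hu μ h1, pointProd_eq_prod hv μ h2, pointProd_eq_prod (hu.mul hv) μ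
    (S := S ∪ S'), ← Finset.prod_mul_distrib]
  · rfl
  · intro p hp
    by_contra h
    have hu1 : u p.1.1 = 1 := by by_contra h'; exact h (h1 p h')
    have hv1 : v p.1.1 = 1 := by by_contra h'; exact h (h2 p h')
    exact hp (by simp [hu1, hv1])

omit [SecondCountableTopology X] in
-- Taking u to be e⁻¹ on B makes -log of the product count the points of B. Hence the functionals
-- `pointProd u` generate the sigma-algebra.
theorem measure_eq_neg_log_pointProd {B : Set X} (hB : MeasurableSet B)
    (hb : Bornology.IsBounded B) : ∃ u : X → ℝ, IsTest u ∧
      ∀ μ : PointMeasure X, μ.1 B = ENNReal.ofReal (-Real.log (pointProd u μ)) := by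
  classical
  refine ⟨_, IsTest.ite hB hb (Real.exp_pos (-1)) (by simp), fun μ => ?_⟩
  have : (fun x => ENNReal.ofReal (-Real.log (if x ∈ B then Real.exp (-1) else 1))) =
      B.indicator 1 := by
    ext x
    by_cases hx : x ∈ B <;> simp [hx]
  rw [pointProd, this, lintegral_indicator_one hB, Real.log_exp, neg_neg,
    ENNReal.ofReal_toReal (μ.apply_lt_top hb).ne]

end TestFunctions

/-! ### Laws of configurations and of tuples determined by generating functionals -/

section Classes

variable {X : Type*} [MetricSpace X] [MeasurableSpace X] [BorelSpace X]
  [SecondCountableTopology X]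

omit [SecondCountableTopology X] in
theorem measurable_of_measurable_pointProd {Ω : Type*} {m : MeasurableSpace Ω}
    {f : Ω → PointMeasure X} (h : ∀ u, IsTest u → Measurable fun a => pointProd u (f a)) :
    Measurable f := by
  refine measurable_pointMeasure fun B hB hb => ?_
  obtain ⟨u, hu, hu'⟩ := measure_eq_neg_log_pointProd hB hb
  simp only [hu']
  exact (h u hu).log.neg.ennreal_ofReal

/-- A family of probability measures on configurations is measurable if it integrates measurably
the functionals `pointProd u`. -/
theorem measurable_of_measurable_lintegral_pointProd {Ω : Type*} [MeasurableSpace Ω]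
    {T : Ω → Measure (PointMeasure X)} [∀ a, IsProbabilityMeasure (T a)]
    (h : ∀ u, IsTest u → Measurable fun a => ∫⁻ μ, ENNReal.ofReal (pointProd u μ) ∂T a) :
    Measurable T := by
  refine measurable_of_measurable_lintegral_multiplicative
    (M := {g | ∃ u : X → ℝ, IsTest u ∧ pointProd u = g}) ?_ ?_ ?_ ?_ ?_ ?_
  · rintro _ ⟨u, hu, rfl⟩; exact measurable_pointProd hu
  · rintro _ ⟨u, hu, rfl⟩ μ; exact pointProd_mem_Icc u μ
  · exact ⟨1, IsTest.one, funext pointProd_one⟩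
  · rintro _ ⟨u, hu, rfl⟩ _ ⟨v, hv, rfl⟩
    exact ⟨u * v, hu.mul hv, funext (pointProd_mul hu hv)⟩
  · have hid := measurable_of_measurable_pointProd
      (m := ⨆ g ∈ {g : PointMeasure X → ℝ | ∃ u : X → ℝ, IsTest u ∧ pointProd u = g},
        MeasurableSpace.comap g (borel ℝ)) (f := id) fun u hu =>
      measurable_iff_comap_le.2 (le_iSup₂_of_le (pointProd u) ⟨u, hu, rfl⟩
        (by rw [BorelSpace.measurable_eq (α := ℝ)]; rfl))
    exact fun s hs => hid hs
  · rintro _ ⟨u, hu, rfl⟩; exact h u hu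

/-- Products of functionals `pointProd` in finitely many configurations. -/
noncomputable def tupleProd {n : ℕ} (u : Fin n → X → ℝ) (κ : Fin n → PointMeasure X) : ℝ :=
  ∏ j, pointProd (u j) (κ j)

/-- The multiplicative class of the functionals `tupleProd u`. -/
def tupleClass (X : Type*) [MetricSpace X] [MeasurableSpace X] (n : ℕ) :
    Set ((Fin n → PointMeasure X) → ℝ) :=
  {g | ∃ u : Fin n → X → ℝ, (∀ j, IsTest (u j)) ∧ tupleProd u = g}

omit [BorelSpace X] [SecondCountableTopology X] in
theorem measurable_tupleProd {n : ℕ} {u : Fin n → X → ℝ} (hu : ∀ j, IsTest (u j)) :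
    Measurable (tupleProd u) :=
  Finset.measurable_prod _ fun j _ => (measurable_pointProd (hu j)).comp (measurable_pi_apply j)

omit [BorelSpace X] [SecondCountableTopology X] in
theorem tupleProd_mem_Icc {n : ℕ} (u : Fin n → X → ℝ) (κ : Fin n → PointMeasure X) :
    tupleProd u κ ∈ Set.Icc (0 : ℝ) 1 :=
  ⟨Finset.prod_nonneg fun _ _ => (pointProd_mem_Icc _ _).1,
    Finset.prod_le_one (fun _ _ => (pointProd_mem_Icc _ _).1) fun _ _ => (pointProd_mem_Icc _ _).2⟩

omit [BorelSpace X] [SecondCountableTopology X] in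
theorem one_mem_tupleClass (n : ℕ) : 1 ∈ tupleClass X n :=
  ⟨fun _ => 1, fun _ => IsTest.one, funext fun κ => by simp [tupleProd, pointProd_one]⟩

theorem mul_mem_tupleClass (n : ℕ) : ∀ g ∈ tupleClass X n, ∀ h ∈ tupleClass X n,
    g * h ∈ tupleClass X n := by
  rintro _ ⟨u, hu, rfl⟩ _ ⟨v, hv, rfl⟩
  refine ⟨fun j => u j * v j, fun j => (hu j).mul (hv j), funext fun κ => ?_⟩
  simp only [tupleProd, Pi.mul_apply, pointProd_mul (hu _) (hv _), Finset.prod_mul_distrib]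

omit [SecondCountableTopology X] in
theorem le_iSup_tupleClass (n : ℕ) :
    (inferInstance : MeasurableSpace (Fin n → PointMeasure X)) ≤
      ⨆ g ∈ tupleClass X n, MeasurableSpace.comap g (borel ℝ) := by
  classical
  have hid : @Measurable _ _ (⨆ g ∈ tupleClass X n, MeasurableSpace.comap g (borel ℝ))
      MeasurableSpace.pi (id : (Fin n → PointMeasure X) → _) := by
    refine @measurable_pi_lambda _ _ _ (_) _ _ fun j => measurable_of_measurable_pointProd
      fun u hu => measurable_iff_comap_le.2 ?_
    refine le_iSup₂_of_le (fun κ => pointProd u (κ j))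
      ⟨fun i => if i = j then u else 1, fun i => ?_, funext fun κ => ?_⟩
      (by rw [BorelSpace.measurable_eq (α := ℝ)]; rfl)
    · by_cases h : i = j
      · simpa [h] using hu
      · simpa [h] using IsTest.one
    · rw [tupleProd, Finset.prod_eq_single j]
      · simp
      · intro i _ hi; simp [hi, pointProd_one]
      · simp
  exact fun s hs => hid hs

/-- A family of probability measures on tuples of configurations is measurable if it integrates
measurably the functionals `tupleProd u`. -/
theorem measurable_of_measurable_lintegral_tupleProd {Ω : Type*} [MeasurableSpace Ω] {n : ℕ}
    {T : Ω → Measure (Fin n → PointMeasure X)} [∀ a, IsProbabilityMeasure (T a)]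
    (h : ∀ u : Fin n → X → ℝ, (∀ j, IsTest (u j)) →
      Measurable fun a => ∫⁻ κ, ENNReal.ofReal (tupleProd u κ) ∂T a) :
    Measurable T := by
  refine measurable_of_measurable_lintegral_multiplicative (M := tupleClass X n) ?_ ?_
    (one_mem_tupleClass n) (mul_mem_tupleClass n) (le_iSup_tupleClass n) ?_
  · rintro _ ⟨u, hu, rfl⟩; exact measurable_tupleProd hu
  · rintro _ ⟨u, hu, rfl⟩ κ; exact tupleProd_mem_Icc u κ
  · rintro _ ⟨u, hu, rfl⟩; exact h u hu

/-- Laws of tuples of configurations are determined by the integrals of the functionals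
`tupleProd u`. -/
theorem ext_of_lintegral_tupleProd {n : ℕ} {μ ν : Measure (Fin n → PointMeasure X)}
    [IsProbabilityMeasure μ] [IsProbabilityMeasure ν]
    (h : ∀ u : Fin n → X → ℝ, (∀ j, IsTest (u j)) →
      ∫⁻ κ, ENNReal.ofReal (tupleProd u κ) ∂μ = ∫⁻ κ, ENNReal.ofReal (tupleProd u κ) ∂ν) :
    μ = ν := by
  refine ext_of_lintegral_multiplicative (M := tupleClass X n) ?_ ?_
    (one_mem_tupleClass n) (mul_mem_tupleClass n) (le_iSup_tupleClass n) ?_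
  · rintro _ ⟨u, hu, rfl⟩; exact measurable_tupleProd hu
  · rintro _ ⟨u, hu, rfl⟩ κ; exact tupleProd_mem_Icc u κ
  · rintro _ ⟨u, hu, rfl⟩; exact h u hu

end Classes

/-! ### Generating functionals of thinnings and multi-splittings -/

section Kernels

variable {X : Type*} [MetricSpace X] [MeasurableSpace X]

/-- The law on `Bool` that gives mass `s` to `true`. -/
noncomputable def coin (s : ℝ) : Measure Bool :=
  ENNReal.ofReal (1 - s) • Measure.dirac false + ENNReal.ofReal s • Measure.dirac true

theorem isProbabilityMeasure_coin {s : ℝ} (h0 : 0 ≤ s) (h1 : s ≤ 1) :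
    IsProbabilityMeasure (coin s) :=
  ⟨by
    simp only [coin, Measure.add_apply, Measure.smul_apply, measure_univ, smul_eq_mul, mul_one]
    rw [← ENNReal.ofReal_add (by linarith) h0]
    simp⟩

theorem lintegral_coin {s : ℝ} (h0 : 0 ≤ s) (h1 : s ≤ 1) {a b : ℝ} (ha : 0 ≤ a) (hb : 0 ≤ b) :
    ∫⁻ c, ENNReal.ofReal (cond c a b) ∂coin s = ENNReal.ofReal (s * a + (1 - s) * b) := by
  rw [coin, lintegral_add_measure, lintegral_smul_measure, lintegral_smul_measure, lintegral_dirac,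
    lintegral_dirac, smul_eq_mul, smul_eq_mul, ← ENNReal.ofReal_mul (by linarith),
    ← ENNReal.ofReal_mul h0, ← ENNReal.ofReal_add, add_comm]
  · rfl
  · exact mul_nonneg (by linarith) hb
  · exact mul_nonneg h0 ha

variable [BorelSpace X] [SecondCountableTopology X]

omit [SecondCountableTopology X] in
theorem measurable_select (μ : PointMeasure X) : Measurable (select μ) := by
  have := countable_points μ
  refine measurable_superposition.comp (measurable_pi_lambda _ fun p => ?_)
  exact (measurable_of_countable fun c : Bool => cond c (pointConfig p.1.1) (emptyConfig X)).comp
    (measurable_pi_apply p)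

omit [SecondCountableTopology X] in
-- Moves all randomness to independent coin tosses indexed by the points; the kept and the remaining
-- configurations become functions of the same tosses.
theorem thinningKernel_eq_map {s : ℝ} (h0 : 0 ≤ s) (h1 : s ≤ 1) (μ : PointMeasure X) :
    thinningKernel s μ = (Measure.infinitePi fun _ : Points μ => coin s).map (select μ) := by
  have := isProbabilityMeasure_coin h0 h1
  have := countable_points μ
  have hm : ∀ p : Points μ, Measurable fun c : Bool =>
      cond c (pointConfig p.1.1) (emptyConfig X) := fun p => measurable_of_countable _
  have hlaw : (fun p : Points μ => ENNReal.ofReal (1 - s) • Measure.dirac (emptyConfig X) +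
      ENNReal.ofReal s • Measure.dirac (pointConfig p.1.1)) =
      fun p : Points μ => (coin s).map fun c => cond c (pointConfig p.1.1) (emptyConfig X) := by
    ext1 p
    rw [coin, Measure.map_add _ _ (hm p), Measure.map_smul, Measure.map_smul,
      Measure.map_dirac' (hm p), Measure.map_dirac' (hm p)]
    rfl
  rw [thinningKernel, convolution, hlaw, ← Measure.infinitePi_map_pi _ hm,
    Measure.map_map (f := fun (b : Points μ → Bool) p => cond (b p) (pointConfig p.1.1)
      (emptyConfig X)) measurable_superposition
      (measurable_pi_lambda _ fun p => (hm p).comp (measurable_pi_apply p))]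
  rfl

omit [SecondCountableTopology X] in
theorem isProbabilityMeasure_thinningKernel {s : ℝ} (h0 : 0 ≤ s) (h1 : s ≤ 1)
    (μ : PointMeasure X) : IsProbabilityMeasure (thinningKernel s μ) := by
  have := isProbabilityMeasure_coin h0 h1
  rw [thinningKernel_eq_map h0 h1]
  exact Measure.isProbabilityMeasure_map (measurable_select μ).aemeasurable

/-- The joint law of the thinned configuration and the residual configuration. -/
theorem lintegral_thinningKernel_residual {s : ℝ} (h0 : 0 ≤ s) (h1 : s ≤ 1) (μ : PointMeasure X)
    {u v : X → ℝ} (hu : IsTest u) (hv : IsTest v) :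
    ∫⁻ κ, ENNReal.ofReal (pointProd u κ * pointProd v (residual μ κ)) ∂thinningKernel s μ =
      ENNReal.ofReal (pointProd (fun x => s * u x + (1 - s) * v x) μ) := by
  classical
  have := isProbabilityMeasure_coin h0 h1
  obtain ⟨S, hS⟩ := exists_finset_points hu μ
  obtain ⟨S', hS'⟩ := exists_finset_points hv μ
  have hu1 : ∀ p : Points μ, u p.1.1 ≠ 1 → p ∈ S ∪ S' := fun p hp => by simp [hS p hp]
  have hv1 : ∀ p : Points μ, v p.1.1 ≠ 1 → p ∈ S ∪ S' := fun p hp => by simp [hS' p hp]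
  have hw1 : ∀ p : Points μ, s * u p.1.1 + (1 - s) * v p.1.1 ≠ 1 → p ∈ S ∪ S' := by
    intro p hp
    by_contra h
    have h1 : u p.1.1 = 1 := by by_contra h'; exact h (hu1 p h')
    have h2 : v p.1.1 = 1 := by by_contra h'; exact h (hv1 p h')
    exact hp (by rw [h1, h2]; ring)
  have hF : Measurable fun κ => ENNReal.ofReal (pointProd u κ * pointProd v (residual μ κ)) :=
    ((measurable_pointProd hu).mul
      ((measurable_pointProd hv).comp (measurable_residual μ))).ennreal_ofReal
  rw [thinningKernel_eq_map h0 h1, lintegral_map hF (measurable_select μ),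
    pointProd_eq_prod (hu.convex hv h0 h1) μ hw1]
  -- Each point contributes u if kept and v otherwise. The factors are independent over points, each
  -- with mean s u + (1 - s) v.
  have hpt : ∀ b : Points μ → Bool,
      ENNReal.ofReal (pointProd u (select μ b) * pointProd v (residual μ (select μ b))) =
        ∏ p ∈ S ∪ S', ENNReal.ofReal (cond (b p) (u p.1.1) (v p.1.1)) := by
    intro b
    rw [residual_select, pointProd_select hu μ b hu1, pointProd_select hv μ _ hv1,
      ← Finset.prod_mul_distrib, ENNReal.ofReal_prod_of_nonneg]
    · refine Finset.prod_congr rfl fun p _ => ?_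
      cases b p <;> simp
    · intro p _
      cases b p
      · simpa using (hv.pos _).le
      · simpa using (hu.pos _).le
  simp only [hpt]
  have hm : ∀ p : Points μ, Measurable fun c : Bool => ENNReal.ofReal (cond c (u p.1.1) (v p.1.1)) :=
    fun p => measurable_of_countable _
  rw [lintegral_prod_eq_prod_lintegral_of_indepFun (S ∪ S')
    (fun (p : Points μ) (b : Points μ → Bool) => ENNReal.ofReal (cond (b p) (u p.1.1) (v p.1.1)))
    (iIndepFun_infinitePi hm) (fun p => (hm p).comp (measurable_pi_apply p)),
    ENNReal.ofReal_prod_of_nonneg]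
  · refine Finset.prod_congr rfl fun p _ => ?_
    rw [← lintegral_coin h0 h1 (hu.pos _).le (hv.pos _).le,
      ← lintegral_map (hm p) (measurable_pi_apply p), Measure.infinitePi_map_eval]
  · exact fun p _ => ((hu.convex hv h0 h1).pos _).le

theorem lintegral_thinningKernel {s : ℝ} (h0 : 0 ≤ s) (h1 : s ≤ 1) (μ : PointMeasure X)
    {u : X → ℝ} (hu : IsTest u) :
    ∫⁻ κ, ENNReal.ofReal (pointProd u κ) ∂thinningKernel s μ =
      ENNReal.ofReal (pointProd (fun x => s * u x + (1 - s) * 1) μ) := by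
  have := lintegral_thinningKernel_residual h0 h1 μ hu IsTest.one
  simpa only [pointProd_one, mul_one, Pi.one_apply] using this

theorem measurable_thinningKernel {s : ℝ} (h0 : 0 ≤ s) (h1 : s ≤ 1) :
    Measurable (thinningKernel s : PointMeasure X → _) := by
  have := isProbabilityMeasure_thinningKernel (X := X) h0 h1
  refine measurable_of_measurable_lintegral_pointProd fun u hu => ?_
  simp only [lintegral_thinningKernel h0 h1 _ hu]
  exact (measurable_pointProd (hu.convex IsTest.one h0 h1)).ennreal_ofReal

theorem isProbabilityMeasure_thinning {s : ℝ} (h0 : 0 ≤ s) (h1 : s ≤ 1)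
    (P : Measure (PointMeasure X)) [IsProbabilityMeasure P] :
    IsProbabilityMeasure (thinning s P) :=
  isProbabilityMeasure_bind (measurable_thinningKernel h0 h1).aemeasurable
    (ae_of_all _ (isProbabilityMeasure_thinningKernel h0 h1))

theorem lintegral_thinning {s : ℝ} (h0 : 0 ≤ s) (h1 : s ≤ 1) (P : Measure (PointMeasure X))
    {u : X → ℝ} (hu : IsTest u) :
    ∫⁻ κ, ENNReal.ofReal (pointProd u κ) ∂thinning s P =
      ∫⁻ μ, ENNReal.ofReal (pointProd (fun x => s * u x + (1 - s) * 1) μ) ∂P := by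
  rw [thinning, Measure.lintegral_bind (measurable_thinningKernel h0 h1).aemeasurable
    (measurable_pointProd hu).ennreal_ofReal.aemeasurable]
  simp only [lintegral_thinningKernel h0 h1 _ hu]

/-- The mixture of the functions `u` that corresponds to iterated thinning. -/
noncomputable def mixture : (n : ℕ) → (Fin n → ℝ) → (Fin (n + 1) → X → ℝ) → X → ℝ
  | 0, _, u => u 0
  | n + 1, s, u => fun x => s 0 * u 0 x + (1 - s 0) * mixture n (Fin.tail s) (Fin.tail u) x

omit [BorelSpace X] [SecondCountableTopology X] in
theorem isTest_mixture {n : ℕ} {s : Fin n → ℝ} (hs : ∀ m, 0 ≤ s m ∧ s m ≤ 1)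
    {u : Fin (n + 1) → X → ℝ} (hu : ∀ j, IsTest (u j)) : IsTest (mixture n s u) := by
  induction n with
  | zero => exact hu 0
  | succ n ih =>
    exact (hu 0).convex (ih (fun m => hs m.succ) (fun j => hu j.succ)) (hs 0).1 (hs 0).2

omit [BorelSpace X] [SecondCountableTopology X] in
theorem measurable_cons {n : ℕ} (κ : PointMeasure X) :
    Measurable (Fin.cons (α := fun _ => PointMeasure X) κ :
      (Fin n → PointMeasure X) → Fin (n + 1) → PointMeasure X) := by
  refine measurable_pi_lambda _ fun j => ?_
  refine Fin.cases ?_ (fun i => ?_) j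
  · simp
  · simpa using measurable_pi_apply i

/-- The explicit formula gives measurability in μ, while `Measure.lintegral_bind` needs a measurable
inner kernel to give the formula; so the claims go through one induction. The inner kernel depends
on κ both through the residual and through the first component, so its measurability in κ is again
read off from the formula. -/
theorem multiThinningKernel_spec {n : ℕ} {s : Fin n → ℝ} (hs : ∀ m, 0 ≤ s m ∧ s m ≤ 1) :
    Measurable (multiThinningKernel n s : PointMeasure X → _) ∧
    (∀ μ : PointMeasure X, IsProbabilityMeasure (multiThinningKernel n s μ)) ∧
    ∀ (μ : PointMeasure X) (u : Fin (n + 1) → X → ℝ), (∀ j, IsTest (u j)) →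
      ∫⁻ κ, ENNReal.ofReal (tupleProd u κ) ∂multiThinningKernel n s μ =
        ENNReal.ofReal (pointProd (mixture n s u) μ) := by
  induction n with
  | zero =>
    have hm : Measurable fun (μ : PointMeasure X) (_ : Fin 1) => μ :=
      measurable_pi_lambda _ fun _ => measurable_id
    refine ⟨Measure.measurable_dirac.comp hm, fun μ => Measure.dirac.isProbabilityMeasure,
      fun μ u hu => ?_⟩
    rw [multiThinningKernel, lintegral_dirac' _ (measurable_tupleProd hu).ennreal_ofReal]
    simp [tupleProd, mixture]
  | succ n ih =>
    obtain ⟨-, ihp, ihf⟩ := ih (s := Fin.tail s) fun m => hs m.succ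
    have hTp := isProbabilityMeasure_thinningKernel (X := X) (hs 0).1 (hs 0).2
    have hKp : ∀ μ κ : PointMeasure X, IsProbabilityMeasure
        ((multiThinningKernel n (Fin.tail s) (residual μ κ)).map
          (Fin.cons (α := fun _ => PointMeasure X) κ)) := fun μ κ =>
      Measure.isProbabilityMeasure_map (measurable_cons κ).aemeasurable
    have hKf : ∀ (μ κ : PointMeasure X) (u : Fin (n + 2) → X → ℝ), (∀ j, IsTest (u j)) →
        ∫⁻ η, ENNReal.ofReal (tupleProd u η)
          ∂(multiThinningKernel n (Fin.tail s) (residual μ κ)).map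
            (Fin.cons (α := fun _ => PointMeasure X) κ) =
          ENNReal.ofReal (pointProd (u 0) κ *
            pointProd (mixture n (Fin.tail s) (Fin.tail u)) (residual μ κ)) := by
      intro μ κ u hu
      have hu' : ∀ j, IsTest (Fin.tail u j) := fun j => hu j.succ
      rw [lintegral_map (measurable_tupleProd hu).ennreal_ofReal (measurable_cons κ),
        ENNReal.ofReal_mul (pointProd_mem_Icc _ _).1, ← ihf _ _ hu',
        ← lintegral_const_mul _ (measurable_tupleProd hu').ennreal_ofReal]
      refine lintegral_congr fun η => ?_
      rw [← ENNReal.ofReal_mul (pointProd_mem_Icc _ _).1, tupleProd, Fin.prod_univ_succ]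
      rfl
    have hKm : ∀ μ : PointMeasure X, Measurable fun κ =>
        (multiThinningKernel n (Fin.tail s) (residual μ κ)).map
          (Fin.cons (α := fun _ => PointMeasure X) κ) := by
      intro μ
      have := hKp μ
      refine measurable_of_measurable_lintegral_tupleProd fun u hu => ?_
      simp only [hKf μ _ u hu]
      exact ((measurable_pointProd (hu 0)).mul ((measurable_pointProd (isTest_mixture
        (fun m => hs m.succ) (fun j => hu j.succ))).comp (measurable_residual μ))).ennreal_ofReal
    have hp : ∀ μ : PointMeasure X, IsProbabilityMeasure (multiThinningKernel (n + 1) s μ) :=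
      fun μ => isProbabilityMeasure_bind (hKm μ).aemeasurable (ae_of_all _ (hKp μ))
    have hf : ∀ (μ : PointMeasure X) (u : Fin (n + 2) → X → ℝ), (∀ j, IsTest (u j)) →
        ∫⁻ κ, ENNReal.ofReal (tupleProd u κ) ∂multiThinningKernel (n + 1) s μ =
          ENNReal.ofReal (pointProd (mixture (n + 1) s u) μ) := by
      intro μ u hu
      rw [multiThinningKernel, Measure.lintegral_bind (hKm μ).aemeasurable
        (measurable_tupleProd hu).ennreal_ofReal.aemeasurable]
      simp only [hKf μ _ u hu]
      exact lintegral_thinningKernel_residual (hs 0).1 (hs 0).2 μ (hu 0)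
        (isTest_mixture (fun m => hs m.succ) fun j => hu j.succ)
    refine ⟨measurable_of_measurable_lintegral_tupleProd fun u hu => ?_, hp, hf⟩
    simp only [hf _ u hu]
    exact (measurable_pointProd (isTest_mixture hs hu)).ennreal_ofReal

/-- The conditional splitting probabilities `q_m / (q_m + ⋯ + q_n)`. -/
noncomputable def splitRatio {n : ℕ} (q : Fin (n + 1) → ℝ) (m : Fin n) : ℝ :=
  q m.castSucc / ∑ i ∈ Finset.Ici m.castSucc, q i

theorem splitRatio_mem {n : ℕ} {q : Fin (n + 1) → ℝ} (hq : ∀ i, 0 < q i) (m : Fin n) :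
    0 ≤ splitRatio q m ∧ splitRatio q m ≤ 1 := by
  have hle : q m.castSucc ≤ ∑ i ∈ Finset.Ici m.castSucc, q i :=
    Finset.single_le_sum (fun i _ => (hq i).le) (by simp)
  have hpos := (hq m.castSucc).trans_le hle
  exact ⟨div_nonneg (hq _).le hpos.le, (div_le_one hpos).2 hle⟩

theorem tail_splitRatio {n : ℕ} (q : Fin (n + 2) → ℝ) :
    Fin.tail (splitRatio q) = splitRatio (Fin.tail q) := by
  ext m
  have h : Finset.Ici (m.succ.castSucc) =
      (Finset.Ici m.castSucc).map ⟨Fin.succ, Fin.succ_injective _⟩ := by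
    ext i
    refine Fin.cases ?_ (fun j => ?_) i
    · simp
    · simp [Fin.le_def]
  simp only [Fin.tail, splitRatio, h, Finset.sum_map]
  rfl

omit [MetricSpace X] [MeasurableSpace X] [BorelSpace X] [SecondCountableTopology X] in
-- The weights are not normalised here because the induction passes to the tail of q. It works since
-- 1 - s_0 is the tail sum over the full sum, which cancels the tail's normalisation.
theorem mixture_splitRatio {n : ℕ} {q : Fin (n + 1) → ℝ} (hq : ∀ i, 0 < q i)
    (u : Fin (n + 1) → X → ℝ) (x : X) :
    mixture n (splitRatio q) u x = (∑ j, q j * u j x) / ∑ j, q j := by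
  induction n with
  | zero => simp [mixture, mul_div_cancel_left₀ _ (hq 0).ne']
  | succ n ih =>
    have hsum : Finset.Ici (0 : Fin (n + 1)).castSucc = Finset.univ := by
      ext i; simp
    have hpos : 0 < ∑ j : Fin (n + 1), q j.succ :=
      Finset.sum_pos (fun i _ => hq i.succ) Finset.univ_nonempty
    have hq' : ∀ i, 0 < Fin.tail q i := fun i => hq i.succ
    simp only [mixture, tail_splitRatio, ih hq', splitRatio, hsum]
    simp only [Fin.sum_univ_succ (n := n + 1), Fin.tail, Fin.castSucc_zero]
    have := hq 0
    field_simp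
    ring

theorem lintegral_multiSplitting {n : ℕ} {q : Fin (n + 1) → ℝ} (hq : ∀ i, 0 < q i)
    (hsum : ∑ i, q i = 1) (P : Measure (PointMeasure X)) {u : Fin (n + 1) → X → ℝ}
    (hu : ∀ j, IsTest (u j)) :
    ∫⁻ κ, ENNReal.ofReal (tupleProd u κ) ∂multiSplitting q P =
      ∫⁻ μ, ENNReal.ofReal (pointProd (fun x => ∑ j, q j * u j x) μ) ∂P := by
  obtain ⟨hm, -, hf⟩ := multiThinningKernel_spec (X := X) (splitRatio_mem hq)
  have hmix : mixture n (splitRatio q) u = fun x => ∑ j, q j * u j x := by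
    ext x; rw [mixture_splitRatio hq, hsum, div_one]
  change ∫⁻ κ, _ ∂P.bind (multiThinningKernel n (splitRatio q)) = _
  rw [Measure.lintegral_bind hm.aemeasurable
    (measurable_tupleProd hu).ennreal_ofReal.aemeasurable]
  simp only [hf _ u hu, hmix]

omit [BorelSpace X] [SecondCountableTopology X] in
theorem isTest_sum {n : ℕ} {q : Fin (n + 1) → ℝ} (hq : ∀ i, 0 < q i)
    (hsum : ∑ i, q i = 1) {u : Fin (n + 1) → X → ℝ} (hu : ∀ j, IsTest (u j)) :
    IsTest fun x => ∑ j, q j * u j x := by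
  have hmix : mixture n (splitRatio q) u = fun x => ∑ j, q j * u j x := by
    ext x; rw [mixture_splitRatio hq, hsum, div_one]
  rw [← hmix]
  exact isTest_mixture (splitRatio_mem hq) hu

theorem isProbabilityMeasure_multiSplitting {n : ℕ} {q : Fin (n + 1) → ℝ} (hq : ∀ i, 0 < q i)
    (P : Measure (PointMeasure X)) [IsProbabilityMeasure P] :
    IsProbabilityMeasure (multiSplitting q P) := by
  obtain ⟨hm, hp, -⟩ := multiThinningKernel_spec (X := X) (splitRatio_mem hq)
  exact isProbabilityMeasure_bind hm.aemeasurable (ae_of_all _ hp)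

omit [BorelSpace X] [SecondCountableTopology X] in
theorem lintegral_tupleProd_pi {n : ℕ} {Q : Fin n → Measure (PointMeasure X)}
    [∀ i, IsProbabilityMeasure (Q i)] {u : Fin n → X → ℝ} (hu : ∀ j, IsTest (u j)) :
    ∫⁻ κ, ENNReal.ofReal (tupleProd u κ) ∂Measure.pi Q =
      ∏ j, ∫⁻ μ, ENNReal.ofReal (pointProd (u j) μ) ∂Q j := by
  have hm : ∀ j, Measurable fun μ : PointMeasure X => ENNReal.ofReal (pointProd (u j) μ) :=
    fun j => (measurable_pointProd (hu j)).ennreal_ofReal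
  have hpt : ∀ κ : Fin n → PointMeasure X, ENNReal.ofReal (tupleProd u κ) =
      ∏ j, ENNReal.ofReal (pointProd (u j) (κ j)) := fun κ =>
    ENNReal.ofReal_prod_of_nonneg fun j _ => (pointProd_mem_Icc _ _).1
  simp only [hpt]
  rw [lintegral_prod_eq_prod_lintegral_of_indepFun Finset.univ
    (fun j (κ : Fin n → PointMeasure X) => ENNReal.ofReal (pointProd (u j) (κ j)))
    (iIndepFun_pi fun j => (hm j).aemeasurable) (fun j => (hm j).comp (measurable_pi_apply j))]
  refine Finset.prod_congr rfl fun j _ => ?_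
  rw [← lintegral_map (hm j) (measurable_pi_apply j), (measurePreserving_eval Q j).map_eq]

end Kernels

/-! ### The Poisson generating functional and the direct implication -/

section Poisson

variable {X : Type*} [MetricSpace X] [MeasurableSpace X]

theorem lintegral_pow_poissonMeasure (r : NNReal) {c : ℝ} (hc : 0 ≤ c) :
    ∫⁻ k, ENNReal.ofReal (c ^ k) ∂poissonMeasure r =
      ENNReal.ofReal (Real.exp (-(r * (1 - c)))) := by
  have hsum : HasSum (fun k : ℕ => Real.exp (-r) * r ^ k / k.factorial * c ^ k)
      (Real.exp (-(r * (1 - c)))) := by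
    have := (NormedSpace.expSeries_div_hasSum_exp (r * c : ℝ)).mul_left (Real.exp (-r))
    rw [← Real.exp_eq_exp_ℝ, ← Real.exp_add] at this
    have h1 : ∀ k : ℕ, Real.exp (-r) * ((r * c : ℝ) ^ k / k.factorial) =
        Real.exp (-r) * r ^ k / k.factorial * c ^ k := fun k => by rw [mul_pow]; ring
    have h2 : -(r : ℝ) + r * c = -(r * (1 - c)) := by ring
    simpa only [h1, h2] using this
  rw [poissonMeasure, lintegral_sum_measure, ← hsum.tsum_eq, ENNReal.ofReal_tsum_of_nonneg
    (fun k => by positivity) hsum.summable]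
  refine tsum_congr fun k => ?_
  rw [lintegral_smul_measure, lintegral_dirac, smul_eq_mul, ENNReal.ofReal_mul (by positivity)]

/-- Integrals of functions of a test function are finite sums over its levels other than `1`. -/
theorem IsTest.exists_levels {u : X → ℝ} (hu : IsTest u) :
    ∃ (k : ℕ) (c : Fin k → ℝ), Function.Injective c ∧ (∀ i, 0 < c i ∧ c i ≤ 1) ∧
      (∀ i, Bornology.IsBounded {x | u x = c i}) ∧
      ∀ (φ : ℝ → ℝ≥0∞), φ 1 = 0 → ∀ m : Measure X,
        ∫⁻ x, φ (u x) ∂m = ∑ i, φ (c i) * m {x | u x = c i} := by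
  classical
  -- The level 1 is dropped: φ vanishes there, and it is the only level whose set may be unbounded.
  let C : Finset ℝ := hu.finite_range.toFinset.erase 1
  have hC : ∀ i, ∃ x, u x = (C.equivFin.symm i : ℝ) := fun i => by
    have := (Finset.mem_erase.1 (C.equivFin.symm i).2).2
    simpa using this
  have hC1 : ∀ i, (C.equivFin.symm i : ℝ) ≠ 1 := fun i =>
    (Finset.mem_erase.1 (C.equivFin.symm i).2).1
  refine ⟨C.card, fun i => C.equivFin.symm i, Subtype.val_injective.comp C.equivFin.symm.injective,
    fun i => ?_, fun i => hu.bounded.subset fun x hx => ?_, fun φ hφ m => ?_⟩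
  · obtain ⟨x, hx⟩ := hC i
    exact ⟨(hu.pos x).trans_eq hx, hx.symm.trans_le (hu.le_one x)⟩
  · have hx : u x = _ := hx
    change u x ≠ 1
    rw [hx]
    exact hC1 i
  · have hms : ∀ c : ℝ, MeasurableSet {x | u x = c} := fun c =>
      hu.measurable (measurableSet_singleton c)
    have h1 : (∑ i, φ (C.equivFin.symm i : ℝ) * m {x | u x = (C.equivFin.symm i : ℝ)}) =
        ∑ c ∈ C, φ c * m {x | u x = c} := by
      rw [← Finset.sum_coe_sort C, ← Equiv.sum_comp C.equivFin.symm]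
    rw [h1]
    have h2 : ∀ x, φ (u x) = ∑ c ∈ C, {x | u x = c}.indicator (fun _ => φ c) x := by
      intro x
      by_cases hx : u x = 1
      · rw [hx, hφ, Finset.sum_eq_zero]
        intro c hc
        refine Set.indicator_of_notMem (fun h => ?_) _
        have h : u x = c := h
        exact (Finset.mem_erase.1 hc).1 (h.symm.trans hx)
      · rw [Finset.sum_eq_single (u x)]
        · exact (Set.indicator_of_mem (s := {y | u y = u x}) rfl fun _ => φ (u x)).symm
        · exact fun c _ hc => Set.indicator_of_notMem (fun h => hc (Eq.symm h)) _
        · intro h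
          exact (h (Finset.mem_erase.2 ⟨hx, by simp⟩)).elim
    simp only [h2]
    rw [lintegral_finsetSum _ fun c _ => measurable_const.indicator (hms c)]
    exact Finset.sum_congr rfl fun c _ => lintegral_indicator_const (hms c) _

theorem lintegral_one_sub_lt_top {u : X → ℝ} (hu : IsTest u) {ϱ : Measure X}
    (hϱ : IsLocallyFinite ϱ) : ∫⁻ x, ENNReal.ofReal (1 - u x) ∂ϱ < ∞ := by
  obtain ⟨k, c, -, -, hb, hφ⟩ := hu.exists_levels
  rw [hφ (fun y => ENNReal.ofReal (1 - y)) (by simp)]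
  exact ENNReal.sum_lt_top.2 fun i _ => ENNReal.mul_lt_top ENNReal.ofReal_lt_top
    (hϱ _ (hu.measurable (measurableSet_singleton _)) (hb i))

variable [BorelSpace X] [SecondCountableTopology X]

theorem exp_neg_log_mul {c : ℝ} (h0 : 0 < c) (h1 : c ≤ 1) (n : ℕ) :
    Real.exp (-(ENNReal.ofReal (-Real.log c) * n).toReal) = c ^ n := by
  rw [ENNReal.toReal_mul, ENNReal.toReal_ofReal (neg_nonneg.2 (Real.log_nonpos h0.le h1)),
    ENNReal.toReal_natCast, neg_mul, neg_neg, mul_comm, Real.exp_nat_mul, Real.exp_log h0]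

omit [SecondCountableTopology X] in
/-- The probability generating functional of a Poisson process. -/
theorem IsPoissonWith.lintegral_pointProd {ϱ : Measure X} (hϱ : IsLocallyFinite ϱ)
    {P : Measure (PointMeasure X)} (hP : IsPoissonWith ϱ P) {u : X → ℝ} (hu : IsTest u) :
    ∫⁻ μ, ENNReal.ofReal (pointProd u μ) ∂P =
      ENNReal.ofReal (Real.exp (-(∫⁻ x, ENNReal.ofReal (1 - u x) ∂ϱ).toReal)) := by
  obtain ⟨k, c, hinj, hc, hb, hφ⟩ := hu.exists_levels
  have hms : ∀ c : ℝ, MeasurableSet {x | u x = c} := fun c =>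
    hu.measurable (measurableSet_singleton c)
  let F : Fin k → ℝ≥0∞ → ℝ≥0∞ := fun i y =>
    ENNReal.ofReal (Real.exp (-(ENNReal.ofReal (-Real.log (c i)) * y).toReal))
  have hF : ∀ i, Measurable (F i) := fun i => by
    exact (Real.measurable_exp.comp (measurable_id.const_mul _).ennreal_toReal.neg).ennreal_ofReal
  -- The level sets are bounded and pairwise disjoint, so this factors the functional into functions
  -- of independent counts.
  have hpt : ∀ μ : PointMeasure X, ENNReal.ofReal (pointProd u μ) =
      ∏ i, F i (μ.1 {x | u x = c i}) := by
    intro μ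
    rw [pointProd, hφ (fun y => ENNReal.ofReal (-Real.log y)) (by simp), ENNReal.toReal_sum,
      ← Finset.sum_neg_distrib, Real.exp_sum, ENNReal.ofReal_prod_of_nonneg]
    · exact fun i _ => (Real.exp_pos _).le
    · exact fun i _ => ENNReal.mul_ne_top ENNReal.ofReal_ne_top (μ.apply_lt_top (hb i)).ne
  have hind := hP.2 k (fun i => {x | u x = c i}) (fun i => hms _) hb fun i j hij =>
    Set.disjoint_left.2 fun x (hx : u x = c i) (hx' : u x = c j) => hij (hinj (hx.symm.trans hx'))
  simp only [hpt]
  rw [lintegral_prod_eq_prod_lintegral_of_indepFun Finset.univ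
    (fun i (μ : PointMeasure X) => F i (μ.1 {x | u x = c i})) (hind.comp F hF)
    (fun i => (hF i).comp (measurable_apply (hms _)))]
  have hone : ∀ i, ∫⁻ μ : PointMeasure X, F i (μ.1 {x | u x = c i}) ∂P = ENNReal.ofReal
      (Real.exp (-(ENNReal.ofReal (1 - c i) * ϱ {x | u x = c i}).toReal)) := by
    intro i
    rw [← lintegral_map (hF i) (measurable_apply (hms _)), hP.1 _ (hms _) (hb i),
      lintegral_map (hF i) (measurable_of_countable _)]
    simp only [F, exp_neg_log_mul (hc i).1 (hc i).2]
    rw [lintegral_pow_poissonMeasure _ (hc i).1.le, ENNReal.toReal_mul,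
      ENNReal.toReal_ofReal (by linarith [(hc i).2]), mul_comm]
    rfl
  simp only [hone]
  rw [← ENNReal.ofReal_prod_of_nonneg fun i _ => (Real.exp_pos _).le, ← Real.exp_sum,
    Finset.sum_neg_distrib, hφ (fun y => ENNReal.ofReal (1 - y)) (by simp), ENNReal.toReal_sum]
  exact fun i _ => ENNReal.mul_ne_top ENNReal.ofReal_ne_top (hϱ _ (hms _) (hb i)).ne

/-- The multi-splitting of a Poisson process has independent components. -/
theorem IsPoisson.multiSplitting_eq_pi {P : Measure (PointMeasure X)} [IsProbabilityMeasure P]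
    (hP : IsPoisson P) {n : ℕ} {q : Fin (n + 1) → ℝ} (hq : ∀ i, 0 < q i ∧ q i < 1)
    (hsum : ∑ i, q i = 1) : multiSplitting q P = Measure.pi fun i => thinning (q i) P := by
  obtain ⟨ϱ, hϱ, hP⟩ := hP
  have := isProbabilityMeasure_multiSplitting (fun i => (hq i).1) P
  have := fun i => isProbabilityMeasure_thinning (hq i).1.le (hq i).2.le P
  refine ext_of_lintegral_tupleProd fun u hu => ?_
  have hw : ∀ j, IsTest fun x => q j * u j x + (1 - q j) * 1 := fun j =>
    (hu j).convex IsTest.one (hq j).1.le (hq j).2.le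
  rw [lintegral_multiSplitting (fun i => (hq i).1) hsum P hu, lintegral_tupleProd_pi hu,
    hP.lintegral_pointProd hϱ (isTest_sum (fun i => (hq i).1) hsum hu)]
  have hmw : ∀ j, Measurable fun x => ENNReal.ofReal (1 - (q j * u j x + (1 - q j) * 1)) :=
    fun j => (measurable_const.sub (hw j).measurable).ennreal_ofReal
  simp only [lintegral_thinning (hq _).1.le (hq _).2.le P (hu _), hP.lintegral_pointProd hϱ (hw _)]
  rw [← ENNReal.ofReal_prod_of_nonneg fun i _ => (Real.exp_pos _).le, ← Real.exp_sum,
    Finset.sum_neg_distrib, ← ENNReal.toReal_sum fun j _ => (lintegral_one_sub_lt_top (hw j) hϱ).ne,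
    ← lintegral_finsetSum _ fun j _ => hmw j]
  -- Since ∑ q_j = 1, what remains is the identity 1 - ∑ q_j u_j = ∑ q_j (1 - u_j) under the
  -- integral.
  congr 4
  refine lintegral_congr fun x => ?_
  rw [← ENNReal.ofReal_sum_of_nonneg fun j _ => sub_nonneg.2 ((hw j).le_one x)]
  congr 1
  have : ∀ j, 1 - (q j * u j x + (1 - q j) * 1) = q j - q j * u j x := fun j => by ring
  simp only [this, Finset.sum_sub_distrib, hsum]

end Poisson

/-! ### The functional equation and the converse implication -/

/-- A function that is additive under the splitting `t = ∑ q_j t` and differentiable at zero is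
linear. -/
theorem eq_of_tendsto_div_of_sum {n : ℕ} {q : Fin (n + 1) → ℝ} (hq : ∀ i, 0 < q i ∧ q i < 1)
    (hsum : ∑ i, q i = 1) {ψ : ℝ → ℝ} {c : ℝ}
    (hψ : ∀ t, 0 < t → t ≤ 1 → ψ t = ∑ j, ψ (q j * t))
    (hlim : Tendsto (fun t => ψ t / t) (𝓝[>] 0) (𝓝 c)) : ψ 1 = c := by
  obtain ⟨j₀, hj₀⟩ := Finite.exists_max q
  refine eq_of_forall_dist_le fun ε hε => ?_
  have hev := hlim.eventually (Metric.closedBall_mem_nhds c hε)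
  obtain ⟨δ, hδ, hball⟩ := mem_nhdsGT_iff_exists_Ioo_subset.1 hev
  have hδ : 0 < δ := hδ
  -- ψ(t)/t is the average of ψ(q_j t)/(q_j t) with weights q_j, so an ε-bound at the smaller
  -- arguments passes to t. After k rounds all arguments are at most q_max^k t, hence below δ.
  have hind : ∀ k : ℕ, ∀ t, 0 < t → t ≤ 1 → q j₀ ^ k * t < δ → |ψ t / t - c| ≤ ε := by
    intro k
    induction k with
    | zero =>
      intro t h0 _ ht
      exact hball ⟨h0, by simpa using ht⟩
    | succ k ih =>
      intro t h0 h1 ht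
      have hqt : ∀ j, |ψ (q j * t) / (q j * t) - c| ≤ ε := by
        intro j
        have hle : q j * t ≤ q j₀ * t := mul_le_mul_of_nonneg_right (hj₀ j) h0.le
        refine ih _ (mul_pos (hq j).1 h0) (mul_le_one₀ (hq j).2.le h0.le h1) (lt_of_le_of_lt ?_ ht)
        rw [pow_succ, mul_assoc]
        exact mul_le_mul_of_nonneg_left hle (pow_nonneg (hq j₀).1.le _)
      have heq : ψ t / t - c = ∑ j, q j * (ψ (q j * t) / (q j * t) - c) := by
        simp only [mul_sub, Finset.sum_sub_distrib, ← Finset.sum_mul, hsum, one_mul]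
        rw [hψ t h0 h1, Finset.sum_div]
        congr 1
        refine Finset.sum_congr rfl fun j _ => ?_
        have := (hq j).1
        field_simp
      rw [heq]
      calc |∑ j, q j * (ψ (q j * t) / (q j * t) - c)|
          ≤ ∑ j, |q j * (ψ (q j * t) / (q j * t) - c)| := Finset.abs_sum_le_sum_abs _ _
        _ ≤ ∑ j, q j * ε := Finset.sum_le_sum fun j _ => by
            rw [abs_mul, abs_of_pos (hq j).1]
            exact mul_le_mul_of_nonneg_left (hqt j) (hq j).1.le
        _ = ε := by rw [← Finset.sum_mul, hsum, one_mul]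
  obtain ⟨k, hk⟩ := exists_pow_lt_of_lt_one hδ (hq j₀).2
  simpa [Real.dist_eq] using hind k 1 one_pos le_rfl (by simpa using hk)

/-- The union bound; it dominates the difference quotients of the generating functional at 0. -/
theorem one_sub_prod_one_sub_le {ι : Type*} (S : Finset ι) {b : ι → ℝ}
    (hb : ∀ i ∈ S, 0 ≤ b i ∧ b i ≤ 1) : 1 - ∏ i ∈ S, (1 - b i) ≤ ∑ i ∈ S, b i := by
  classical
  induction S using Finset.induction_on with
  | empty => simp
  | insert i S hi ih =>
    rw [Finset.prod_insert hi, Finset.sum_insert hi]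
    have h1 := ih fun j hj => hb j (Finset.mem_insert_of_mem hj)
    have h2 := hb i (Finset.mem_insert_self i S)
    have h3 : ∏ j ∈ S, (1 - b j) ≤ 1 := Finset.prod_le_one
      (fun j hj => sub_nonneg.2 (hb j (Finset.mem_insert_of_mem hj)).2)
      fun j hj => by linarith [(hb j (Finset.mem_insert_of_mem hj)).1]
    nlinarith

section Converse

variable {X : Type*} [MetricSpace X] [MeasurableSpace X] [BorelSpace X]
  [SecondCountableTopology X]

/-- The test function `1 - t (1 - u)`. -/
def interp (u : X → ℝ) (t : ℝ) (x : X) : ℝ := t * u x + (1 - t) * 1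

omit [BorelSpace X] [SecondCountableTopology X] in
theorem IsTest.interp {u : X → ℝ} (hu : IsTest u) {t : ℝ} (h0 : 0 ≤ t) (h1 : t ≤ 1) :
    IsTest (interp u t) := hu.convex IsTest.one h0 h1

theorem toReal_lintegral_one_sub {u : X → ℝ} (hu : IsTest u) (μ : PointMeasure X)
    {S : Finset (Points μ)} (hS : ∀ p, u p.1.1 ≠ 1 → p ∈ S) :
    (∫⁻ x, ENNReal.ofReal (1 - u x) ∂μ.1).toReal = ∑ p ∈ S, (1 - u p.1.1) := by
  have hm : Measurable fun x => ENNReal.ofReal (1 - u x) :=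
    (measurable_const.sub hu.measurable).ennreal_ofReal
  rw [lintegral_eq_tsum_points μ hm, tsum_eq_sum (s := S), ← ENNReal.ofReal_sum_of_nonneg fun p _ => sub_nonneg.2 (hu.le_one _),
    ENNReal.toReal_ofReal (Finset.sum_nonneg fun p _ => sub_nonneg.2 (hu.le_one _))]
  intro p hp
  have : u p.1.1 = 1 := by by_contra h; exact hp (hS p h)
  simp [this]

theorem pointProd_interp {u : X → ℝ} (hu : IsTest u) (μ : PointMeasure X)
    {S : Finset (Points μ)} (hS : ∀ p, u p.1.1 ≠ 1 → p ∈ S) {t : ℝ} (h0 : 0 ≤ t) (h1 : t ≤ 1) :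
    pointProd (interp u t) μ = ∏ p ∈ S, (1 - t * (1 - u p.1.1)) := by
  rw [pointProd_eq_prod (hu.interp h0 h1) μ (S := S)]
  · exact Finset.prod_congr rfl fun p _ => by rw [interp]; ring
  · intro p hp
    refine hS p fun h => hp ?_
    rw [interp, h]; ring

theorem one_sub_pointProd_interp_le {u : X → ℝ} (hu : IsTest u) (μ : PointMeasure X)
    {t : ℝ} (h0 : 0 ≤ t) (h1 : t ≤ 1) :
    1 - pointProd (interp u t) μ ≤ t * (∫⁻ x, ENNReal.ofReal (1 - u x) ∂μ.1).toReal := by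
  obtain ⟨S, hS⟩ := exists_finset_points hu μ
  rw [pointProd_interp hu μ hS h0 h1, toReal_lintegral_one_sub hu μ hS, Finset.mul_sum]
  refine one_sub_prod_one_sub_le S fun p _ => ?_
  have h2 := hu.le_one p.1.1
  have h3 := hu.pos p.1.1
  exact ⟨mul_nonneg h0 (by linarith), mul_le_one₀ h1 (by linarith) (by linarith)⟩

/-- The derivative at t = 0 of a finite product whose factors are all 1 there, so only the sum of
the derivatives survives. -/
theorem tendsto_pointProd_interp {u : X → ℝ} (hu : IsTest u) (μ : PointMeasure X) :
    Tendsto (fun t => (1 - pointProd (interp u t) μ) / t) (𝓝[>] 0)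
      (𝓝 (∫⁻ x, ENNReal.ofReal (1 - u x) ∂μ.1).toReal) := by
  classical
  obtain ⟨S, hS⟩ := exists_finset_points hu μ
  have hd : HasDerivAt (fun t : ℝ => ∏ p ∈ S, (1 - t * (1 - u p.1.1)))
      (-∑ p ∈ S, (1 - u p.1.1)) 0 := by
    have := HasDerivAt.fun_finsetProd (u := S)
      (f := fun (p : Points μ) (t : ℝ) => 1 - t * (1 - u p.1.1))
      (f' := fun p => -(1 - u p.1.1)) (x := (0 : ℝ)) fun p _ => by
        simpa using ((hasDerivAt_id (0 : ℝ)).mul_const (1 - u p.1.1)).const_sub 1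
    simpa only [zero_mul, sub_zero, Finset.prod_const_one, one_smul, Finset.sum_neg_distrib]
      using this
  have := hd.tendsto_slope_zero_right.neg
  rw [neg_neg, ← toReal_lintegral_one_sub hu μ hS] at this
  refine this.congr' ?_
  filter_upwards [Ioo_mem_nhdsGT (zero_lt_one (α := ℝ))] with t ht
  rw [pointProd_interp hu μ hS ht.1.le ht.2.le]
  simp [div_eq_inv_mul]
  ring

omit [BorelSpace X] [SecondCountableTopology X] in
theorem lintegral_firstMoment (P : Measure (PointMeasure X)) {f : X → ℝ≥0∞} (hf : Measurable f) :
    ∫⁻ x, f x ∂firstMoment P = ∫⁻ μ, ∫⁻ x, f x ∂μ.1 ∂P :=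
  Measure.lintegral_bind measurable_subtype_coe.aemeasurable hf.aemeasurable

omit [BorelSpace X] [SecondCountableTopology X] in
theorem integrable_pointProd (P : Measure (PointMeasure X)) [IsProbabilityMeasure P] {u : X → ℝ}
    (hu : IsTest u) : Integrable (pointProd u) P :=
  Integrable.of_bound (C := 1) (measurable_pointProd hu).aestronglyMeasurable
    (ae_of_all _ fun μ => by
      rw [Real.norm_eq_abs, abs_of_nonneg (pointProd_mem_Icc u μ).1]
      exact (pointProd_mem_Icc u μ).2)

omit [BorelSpace X] [SecondCountableTopology X] in
theorem integral_pointProd_pos (P : Measure (PointMeasure X)) [IsProbabilityMeasure P] {u : X → ℝ}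
    (hu : IsTest u) : 0 < ∫ μ, pointProd u μ ∂P := by
  refine (integral_pos_iff_support_of_nonneg (fun μ => (pointProd_mem_Icc u μ).1)
    (integrable_pointProd P hu)).2 ?_
  have : Function.support (pointProd u) = Set.univ :=
    Set.eq_univ_of_forall fun μ => (Real.exp_pos _).ne'
  rw [this, measure_univ]
  exact one_pos

/-- Differentiation under the integral: the quotients are bounded by ∫ (1 - u) dμ, which is
P-integrable because P is of first order. -/
theorem tendsto_integral_pointProd_interp {P : Measure (PointMeasure X)} [IsProbabilityMeasure P]
    (hP : IsFirstOrder P) {u : X → ℝ} (hu : IsTest u) :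
    Tendsto (fun t => (1 - ∫ μ, pointProd (interp u t) μ ∂P) / t) (𝓝[>] 0)
      (𝓝 (∫⁻ x, ENNReal.ofReal (1 - u x) ∂firstMoment P).toReal) := by
  have hmf : Measurable fun x => ENNReal.ofReal (1 - u x) :=
    (measurable_const.sub hu.measurable).ennreal_ofReal
  have hmΛ : Measurable fun μ : PointMeasure X => ∫⁻ x, ENNReal.ofReal (1 - u x) ∂μ.1 :=
    (Measure.measurable_lintegral hmf).comp measurable_subtype_coe
  have hfin := (lintegral_one_sub_lt_top hu hP).ne
  rw [lintegral_firstMoment P hmf] at hfin ⊢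
  rw [← integral_toReal hmΛ.aemeasurable (ae_lt_top hmΛ hfin)]
  have h01 : Set.Ioo (0 : ℝ) 1 ∈ 𝓝[>] (0 : ℝ) := Ioo_mem_nhdsGT zero_lt_one
  refine Tendsto.congr' (f₁ := fun t => ∫ μ, (1 - pointProd (interp u t) μ) / t ∂P) ?_ ?_
  · filter_upwards [h01] with t ht
    rw [integral_div, integral_sub (integrable_const _)
      (integrable_pointProd P (hu.interp ht.1.le ht.2.le))]
    simp
  · refine tendsto_integral_filter_of_dominated_convergence
      (fun μ => (∫⁻ x, ENNReal.ofReal (1 - u x) ∂μ.1).toReal) ?_ ?_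
      (integrable_toReal_of_lintegral_ne_top hmΛ.aemeasurable hfin)
      (ae_of_all _ fun μ => tendsto_pointProd_interp hu μ)
    · filter_upwards [h01] with t ht
      exact ((measurable_const.sub (measurable_pointProd
        (hu.interp ht.1.le ht.2.le))).div_const t).aestronglyMeasurable
    · filter_upwards [h01] with t ht
      refine ae_of_all _ fun μ => ?_
      rw [Real.norm_eq_abs, abs_of_nonneg
        (div_nonneg (sub_nonneg.2 (pointProd_mem_Icc _ μ).2) ht.1.le), div_le_iff₀' ht.1]
      exact one_sub_pointProd_interp_le hu μ ht.1.le ht.2.le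

/-- If the multi-splitting has independent components, then the probability generating functional
is that of a Poisson process. -/
theorem integral_pointProd_of_multiSplitting {P : Measure (PointMeasure X)}
    [IsProbabilityMeasure P] (hP : IsFirstOrder P) {n : ℕ} {q : Fin (n + 1) → ℝ}
    (hq : ∀ i, 0 < q i ∧ q i < 1) (hsum : ∑ i, q i = 1)
    (h : multiSplitting q P = Measure.pi fun i => thinning (q i) P) {u : X → ℝ} (hu : IsTest u) :
    ∫ μ, pointProd u μ ∂P =
      Real.exp (-(∫⁻ x, ENNReal.ofReal (1 - u x) ∂firstMoment P).toReal) := by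
  have := fun i => isProbabilityMeasure_thinning (hq i).1.le (hq i).2.le P
  let φ : ℝ → ℝ := fun t => ∫ μ, pointProd (interp u t) μ ∂P
  have hof : ∀ v : X → ℝ, IsTest v →
      ∫⁻ μ, ENNReal.ofReal (pointProd v μ) ∂P = ENNReal.ofReal (∫ μ, pointProd v μ ∂P) :=
    fun v hv => (ofReal_integral_eq_lintegral_ofReal (integrable_pointProd P hv)
      (ae_of_all _ fun μ => (pointProd_mem_Icc v μ).1)).symm
  have hφ0 : φ 0 = 1 := by
    have : interp u 0 = 1 := by ext x; simp [interp]
    simp [φ, this, pointProd_one]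
  have hφ1 : φ 1 = ∫ μ, pointProd u μ ∂P := by
    have : interp u 1 = u := by ext x; simp [interp]
    simp only [φ, this]
  have hφpos : ∀ t, 0 ≤ t → t ≤ 1 → 0 < φ t := fun t h0 h1 =>
    integral_pointProd_pos P (hu.interp h0 h1)
  -- The same function 1 - t (1 - u) is put in every coordinate: the splitting side averages it to
  -- itself, and thinning by q_j replaces t by q_j t.
  have hmul : ∀ t, 0 < t → t ≤ 1 → φ t = ∏ j, φ (q j * t) := by
    intro t h0 h1
    have hw := hu.interp h0.le h1
    have hqt : ∀ j, 0 ≤ q j * t ∧ q j * t ≤ 1 := fun j =>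
      ⟨(mul_pos (hq j).1 h0).le, mul_le_one₀ (hq j).2.le h0.le h1⟩
    have e1 := lintegral_multiSplitting (fun i => (hq i).1) hsum P (fun _ => hw)
    rw [h, lintegral_tupleProd_pi (fun _ => hw)] at e1
    have e2 : (fun x => ∑ j, q j * interp u t x) = interp u t := by
      ext x; rw [← Finset.sum_mul, hsum, one_mul]
    have e3 : ∀ j, (fun x => q j * interp u t x + (1 - q j) * 1) = interp u (q j * t) := fun j => by
      ext x; simp only [interp]; ring
    rw [e2, hof _ hw] at e1
    simp only [lintegral_thinning (hq _).1.le (hq _).2.le P hw, e3] at e1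
    simp only [hof _ (hu.interp (hqt _).1 (hqt _).2)] at e1
    rw [← ENNReal.ofReal_prod_of_nonneg fun j _ => (hφpos _ (hqt j).1 (hqt j).2).le] at e1
    exact ((ENNReal.ofReal_eq_ofReal_iff
      (Finset.prod_nonneg fun j _ => (hφpos _ (hqt j).1 (hqt j).2).le)
      (hφpos t h0.le h1).le).1 e1).symm
  -- As φ(0) = 1, passing to -log only changes the sign of the right derivative at 0.
  have hlim : Tendsto (fun t => -Real.log (φ t) / t) (𝓝[>] 0)
      (𝓝 (∫⁻ x, ENNReal.ofReal (1 - u x) ∂firstMoment P).toReal) := by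
    have hd : HasDerivWithinAt φ (-(∫⁻ x, ENNReal.ofReal (1 - u x) ∂firstMoment P).toReal)
        (Set.Ioi 0) 0 := by
      rw [hasDerivWithinAt_iff_tendsto_slope' (by simp)]
      refine (tendsto_integral_pointProd_interp hP hu).neg.congr fun t => ?_
      rw [slope_def_field, hφ0, sub_zero, ← neg_div, neg_sub]
    have hl := hd.log (by rw [hφ0]; exact one_ne_zero)
    rw [hφ0, div_one, hasDerivWithinAt_iff_tendsto_slope' (by simp)] at hl
    have := hl.neg
    rw [neg_neg] at this
    refine this.congr fun t => ?_
    rw [slope_def_field, hφ0, Real.log_one, sub_zero, sub_zero, neg_div]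
  have hmain := eq_of_tendsto_div_of_sum hq hsum (ψ := fun t => -Real.log (φ t))
    (fun t h0 h1 => by
      rw [hmul t h0 h1, Real.log_prod, Finset.sum_neg_distrib]
      exact fun j _ => (hφpos _ (mul_pos (hq j).1 h0).le
        (mul_le_one₀ (hq j).2.le h0.le h1)).ne') hlim
  rw [← hφ1, ← hmain, neg_neg, Real.exp_log (hφpos 1 zero_le_one le_rfl)]

end Converse

/-! ### From the generating functional to Poisson counts -/

section Counts

variable {X : Type*} [MetricSpace X] [MeasurableSpace X]

/-- The number of points of `μ` in `B`. -/
noncomputable def count (B : Set X) (μ : PointMeasure X) : ℕ := ⌊(μ.1 B).toReal⌋₊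

theorem count_eq {B : Set X} (hB : MeasurableSet B) (hb : Bornology.IsBounded B)
    (μ : PointMeasure X) : (count B μ : ℝ≥0∞) = μ.1 B := by
  obtain ⟨k, hk⟩ := μ.2 B hB hb
  simp [count, hk]

theorem IsTest.finset_prod {ι : Type*} {u : ι → X → ℝ} (S : Finset ι)
    (hu : ∀ i, IsTest (u i)) : IsTest (∏ i ∈ S, u i) :=
  Finset.prod_induction _ IsTest (fun _ _ => IsTest.mul) IsTest.one fun i _ => hu i

variable [BorelSpace X] [SecondCountableTopology X]

omit [BorelSpace X] [SecondCountableTopology X] in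
theorem measurable_count {B : Set X} (hB : MeasurableSet B) : Measurable (count B) :=
  Nat.measurable_floor.comp (measurable_apply hB).ennreal_toReal

theorem pointProd_finset_prod {ι : Type*} {u : ι → X → ℝ} (S : Finset ι)
    (hu : ∀ i, IsTest (u i)) (μ : PointMeasure X) :
    pointProd (∏ i ∈ S, u i) μ = ∏ i ∈ S, pointProd (u i) μ := by
  classical
  induction S using Finset.induction_on with
  | empty => simpa using pointProd_one μ
  | insert i S hi ih =>
    rw [Finset.prod_insert hi, Finset.prod_insert hi,
      pointProd_mul (hu i) (IsTest.finset_prod S hu), ih]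

omit [BorelSpace X] [SecondCountableTopology X] in
open scoped Classical in
theorem pointProd_ite {B : Set X} (hB : MeasurableSet B) (hb : Bornology.IsBounded B) {c : ℝ}
    (h0 : 0 < c) (h1 : c ≤ 1) (μ : PointMeasure X) :
    pointProd (fun x => if x ∈ B then c else 1) μ = c ^ count B μ := by
  have : (fun x => ENNReal.ofReal (-Real.log (if x ∈ B then c else 1))) =
      B.indicator fun _ => ENNReal.ofReal (-Real.log c) := by
    ext x
    by_cases hx : x ∈ B <;> simp [hx]
  rw [pointProd, this, lintegral_indicator_const hB, ← count_eq hB hb, exp_neg_log_mul h0 h1]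

/-- Laws on `ℕ^k` are determined by their probability generating functions. -/
theorem ext_of_lintegral_prod_pow {k : ℕ} {μ ν : Measure (Fin k → ℕ)} [IsProbabilityMeasure μ]
    [IsProbabilityMeasure ν]
    (h : ∀ c : Fin k → ℝ, (∀ i, 0 < c i ∧ c i ≤ 1) →
      ∫⁻ m, ENNReal.ofReal (∏ i, c i ^ m i) ∂μ = ∫⁻ m, ENNReal.ofReal (∏ i, c i ^ m i) ∂ν) :
    μ = ν := by
  classical
  refine ext_of_lintegral_multiplicative
    (M := {g | ∃ c : Fin k → ℝ, (∀ i, 0 < c i ∧ c i ≤ 1) ∧ (fun m => ∏ i, c i ^ m i) = g})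
    ?_ ?_ ?_ ?_ ?_ ?_
  · rintro _ ⟨c, -, rfl⟩; exact measurable_of_countable _
  · rintro _ ⟨c, hc, rfl⟩ m
    exact ⟨Finset.prod_nonneg fun i _ => pow_nonneg (hc i).1.le _,
      Finset.prod_le_one (fun i _ => pow_nonneg (hc i).1.le _)
        fun i _ => pow_le_one₀ (hc i).1.le (hc i).2⟩
  · exact ⟨fun _ => 1, fun _ => ⟨one_pos, le_rfl⟩, by ext m; simp⟩
  · rintro _ ⟨c, hc, rfl⟩ _ ⟨d, hd, rfl⟩
    refine ⟨fun i => c i * d i, fun i => ⟨mul_pos (hc i).1 (hd i).1,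
      mul_le_one₀ (hc i).2 (hd i).1.le (hd i).2⟩, ?_⟩
    ext m
    simp [mul_pow, Finset.prod_mul_distrib]
  · set M : Set ((Fin k → ℕ) → ℝ) :=
      {g | ∃ c : Fin k → ℝ, (∀ i, 0 < c i ∧ c i ≤ 1) ∧ (fun m => ∏ i, c i ^ m i) = g}
    have hid : @Measurable _ _ (⨆ g ∈ M, MeasurableSpace.comap g (borel ℝ))
        MeasurableSpace.pi (id : (Fin k → ℕ) → _) := by
      refine @measurable_pi_lambda _ _ _ (_) _ _ fun j => ?_
      -- With this choice -log of the monomial is the coordinate m_j, so the monomials generate the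
      -- sigma-algebra.
      let c : Fin k → ℝ := fun i => if i = j then Real.exp (-1) else 1
      have hc : ∀ i, 0 < c i ∧ c i ≤ 1 := fun i => by
        by_cases hi : i = j
        · simp [c, hi, Real.exp_pos]
        · simp [c, hi]
      have hg : @Measurable _ _ (⨆ g ∈ M, MeasurableSpace.comap g (borel ℝ)) _
          fun m : Fin k → ℕ => ∏ i, c i ^ m i :=
        measurable_iff_comap_le.2 (le_iSup₂_of_le (fun m : Fin k → ℕ => ∏ i, c i ^ m i)
          ⟨c, hc, rfl⟩ (by rw [BorelSpace.measurable_eq (α := ℝ)]))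
      have hj : (fun m : Fin k → ℕ => id m j) =
          fun m => ⌊-Real.log (∏ i, c i ^ m i)⌋₊ := by
        ext m
        rw [Finset.prod_eq_single j]
        · simp [c]
        · intro i _ hi; simp [c, hi]
        · simp
      rw [hj]
      exact Nat.measurable_floor.comp hg.log.neg
    exact fun s hs => hid hs
  · rintro _ ⟨c, hc, rfl⟩; exact h c hc

/-- A point process with the probability generating functional of a Poisson process is one. -/
theorem isPoissonWith_of_integral_pointProd {P : Measure (PointMeasure X)}
    [IsProbabilityMeasure P] {ϱ : Measure X} (hϱ : IsLocallyFinite ϱ)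
    (h : ∀ u : X → ℝ, IsTest u → ∫ μ, pointProd u μ ∂P =
      Real.exp (-(∫⁻ x, ENNReal.ofReal (1 - u x) ∂ϱ).toReal)) : IsPoissonWith ϱ P := by
  classical
  -- The joint generating function of the counts is the functional at the test function equal to c_i
  -- on B_i, so marginals and independence come out together.
  have hjoint : ∀ (k : ℕ) (B : Fin k → Set X), (∀ i, MeasurableSet (B i)) →
      (∀ i, Bornology.IsBounded (B i)) → Pairwise (fun i j => Disjoint (B i) (B j)) →
      P.map (fun μ i => count (B i) μ) =
        Measure.pi fun i => poissonMeasure (ϱ (B i)).toNNReal := by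
    intro k B hB hb hdisj
    have hm : Measurable fun (μ : PointMeasure X) i => count (B i) μ :=
      measurable_pi_lambda _ fun i => measurable_count (hB i)
    have := Measure.isProbabilityMeasure_map (μ := P) hm.aemeasurable
    refine ext_of_lintegral_prod_pow fun c hc => ?_
    rw [lintegral_map (measurable_of_countable _) hm]
    have hu : ∀ i, IsTest fun x => if x ∈ B i then c i else 1 := fun i =>
      IsTest.ite (hB i) (hb i) (hc i).1 (hc i).2
    have hU := IsTest.finset_prod Finset.univ hu
    have h1 : ∀ μ : PointMeasure X, ∏ i, c i ^ count (B i) μ =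
        pointProd (∏ i, fun x => if x ∈ B i then c i else 1) μ := fun μ => by
      rw [pointProd_finset_prod _ hu]
      exact Finset.prod_congr rfl fun i _ => (pointProd_ite (hB i) (hb i) (hc i).1 (hc i).2 μ).symm
    simp only [h1]
    rw [← ofReal_integral_eq_lintegral_ofReal (integrable_pointProd P hU)
      (ae_of_all _ fun μ => (pointProd_mem_Icc _ μ).1), h _ hU]
    -- By disjointness at most one factor differs from 1 at x, so one minus the product is a sum
    -- over the sets and the exponential splits.
    have h2 : ∀ x, ENNReal.ofReal (1 - (∏ i, fun x => if x ∈ B i then c i else 1) x) =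
        ∑ i, (B i).indicator (fun _ => ENNReal.ofReal (1 - c i)) x := by
      intro x
      rw [Finset.prod_apply]
      by_cases hx : ∃ i, x ∈ B i
      · obtain ⟨i, hi⟩ := hx
        have hne : ∀ j, j ≠ i → x ∉ B j := fun j hj hxj =>
          Set.disjoint_left.1 (hdisj hj) hxj hi
        rw [Finset.prod_eq_single i (fun j _ hj => if_neg (hne j hj)) (by simp),
          Finset.sum_eq_single i (fun j _ hj => Set.indicator_of_notMem (hne j hj) _) (by simp),
          if_pos hi, Set.indicator_of_mem hi]
      · push Not at hx
        simp [hx]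
    simp only [h2]
    rw [lintegral_finsetSum _ fun i _ => measurable_const.indicator (hB i)]
    simp only [lintegral_indicator_const (hB _)]
    rw [ENNReal.toReal_sum fun i _ =>
      ENNReal.mul_ne_top ENNReal.ofReal_ne_top (hϱ _ (hB i) (hb i)).ne,
      ← Finset.sum_neg_distrib, Real.exp_sum,
      ENNReal.ofReal_prod_of_nonneg fun i _ => (Real.exp_pos _).le]
    have h3 : ∀ m : Fin k → ℕ, ENNReal.ofReal (∏ i, c i ^ m i) =
        ∏ i, ENNReal.ofReal (c i ^ m i) := fun m =>
      ENNReal.ofReal_prod_of_nonneg fun i _ => pow_nonneg (hc i).1.le _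
    simp only [h3]
    have hmp : ∀ i, Measurable fun j : ℕ => ENNReal.ofReal (c i ^ j) := fun i =>
      measurable_of_countable _
    rw [lintegral_prod_eq_prod_lintegral_of_indepFun Finset.univ
      (fun i (m : Fin k → ℕ) => ENNReal.ofReal (c i ^ m i))
      (iIndepFun_pi fun i => (hmp i).aemeasurable) (fun i => (hmp i).comp (measurable_pi_apply i))]
    refine Finset.prod_congr rfl fun i _ => ?_
    have h4 := lintegral_map (μ := Measure.pi fun i => poissonMeasure (ϱ (B i)).toNNReal) (hmp i)
      (measurable_pi_apply i)
    rw [(measurePreserving_eval _ i).map_eq, lintegral_pow_poissonMeasure _ (hc i).1.le] at h4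
    rw [← h4, ENNReal.toReal_mul, ENNReal.toReal_ofReal (by linarith [(hc i).2]), mul_comm]
    rfl
  have hone : ∀ B : Set X, MeasurableSet B → Bornology.IsBounded B →
      P.map (count B) = poissonMeasure (ϱ B).toNNReal := by
    intro B hB hb
    have h1 := hjoint 1 (fun _ => B) (fun _ => hB) (fun _ => hb) (Subsingleton.pairwise)
    have h2 := congrArg (Measure.map (Function.eval (0 : Fin 1))) h1
    rw [(measurePreserving_eval _ (0 : Fin 1)).map_eq, Measure.map_map (measurable_pi_apply 0)
      (measurable_pi_lambda _ fun _ => measurable_count hB)] at h2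
    exact h2
  have hcast : Measurable fun j : ℕ => (j : ℝ≥0∞) := measurable_of_countable _
  have hval : ∀ B : Set X, MeasurableSet B → Bornology.IsBounded B →
      (fun μ : PointMeasure X => μ.1 B) = fun μ => (count B μ : ℝ≥0∞) := fun B hB hb =>
    funext fun μ => (count_eq hB hb μ).symm
  refine ⟨fun B hB hb => ?_, fun k B hB hb hdisj => ?_⟩
  · rw [hval B hB hb, ← hone B hB hb, Measure.map_map hcast (measurable_count hB)]
    rfl
  · have hind : iIndepFun (fun i (μ : PointMeasure X) => count (B i) μ) P := by
      rw [iIndepFun_iff_map_fun_eq_pi_map fun i => (measurable_count (hB i)).aemeasurable,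
        hjoint k B hB hb hdisj]
      exact congrArg Measure.pi (funext fun i => (hone _ (hB i) (hb i)).symm)
    have hB' : (fun i (μ : PointMeasure X) => μ.1 (B i)) =
        fun i μ => (count (B i) μ : ℝ≥0∞) := funext fun i => hval _ (hB i) (hb i)
    rw [hB']
    exact hind.comp (fun _ j => (j : ℝ≥0∞)) fun _ => hcast

end Counts

end PointProcess

theorem theorem2 {X : Type*} [MetricSpace X] [PolishSpace X] [MeasurableSpace X] [BorelSpace X]
    (P : Measure (PointProcess.PointMeasure X)) [IsProbabilityMeasure P]
    (hP : PointProcess.IsFirstOrder P)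
    (n : ℕ) (q : Fin (n + 1) → ℝ) (hq : ∀ i, 0 < q i ∧ q i < 1) (hsum : ∑ i, q i = 1) :
    PointProcess.IsPoisson P ↔
      PointProcess.multiSplitting q P =
        Measure.pi fun i => PointProcess.thinning (q i) P :=
  -- The intensity is the first moment measure, whose local finiteness is the first-order hypothesis
  -- itself.
  ⟨fun h => h.multiSplitting_eq_pi hq hsum, fun h => ⟨PointProcess.firstMoment P, hP,
    PointProcess.isPoissonWith_of_integral_pointProd hP fun _ hu =>
      PointProcess.integral_pointProd_of_multiSplitting hP hq hsum h hu⟩⟩
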